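/- Consider the primal-dual pair of semidefinite problems $$\min\{C\bullet X : A^{(i)}\bullet X=b_i\ (i=1,\dots,m),\ X\succeq 0\},\qquad \max\{b^{\top}y : \textstyle\sum_i y_iA^{(i)}+S=C,\ S\succeq 0\},$$ where $C,A^{(1)},\dots,A^{(m)}$ are real symmetric $n\times n$ matrices ($n\ge 1$), the $A^{(i)}$ are linearly independent, and $U\bullet V=\operatorname{tr}(UV)$. Write $\mathcal A X=(A^{(i)}\bullet X)_i$, $\mathcal A^{\top}y=\sum_i y_iA^{(i)}$, $\mathcal A^{+}=\mathcal A^{\top}(\mathcal A\mathcal A^{\top})^{-1}$; $\|\cdot\|$ is the Euclidean norm of vectors and the Frobenius norm of matrices. For invertible $P$ let $H_P(M)=\frac12(PMP^{-1}+P^{-\top}M^{\top}P^{\top})$; below $P=S^{1/2}$ (HKM direction), where $S$ is the current dual slack matrix. Fix $\gamma_1,\gamma_2,\eta_2\in(0,1)$ and $\eta_1\in(0,1]$ with $\eta_2\le\eta_1$. Starting point: $\tau_0=\theta_0=1$, $X_0=S_0=\rho I$ with $\rho>0$, and $y_0\in\mathbb R^m$ arbitrary; it is assumed that for some primal-dual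 optimal solution $(X^*,y^*,S^*)$ (feasible, with zero duality gap) $$(1-\gamma_1)X_0\succeq X^*,\quad (1-\gamma_1)S_0\succeq S^*,\quad \rho\ge\tfrac1n(\operatorname{tr}X^*+\operatorname{tr}S^*).$$ Put $\mu_0=\rho^2$, $R^p(X)=\mathcal AX-b$, $R^d(y,S)=\mathcal A^{\top}y+S-C$, $R_0^p=R^p(X_0)$, $R_0^d=R^d(y_0,S_0)$. The neighbourhood $\mathcal N_I$ is the set of all $(\tau,\theta,X,y,S)$ with $0\le\tau\le\theta$, $X\succeq0$, $S\succ0$, $R^d(y,S)=\tau(R_0^d+\zeta^d)$ for some $\|\zeta^d\|\le\gamma_1\rho$, $R^p(X)=\tau(R^p_0+\zeta^p)$ for some $\|\mathcal A^{+}\zeta^p\|\le\gamma_1\rho$, and $\|H_P(XS)-\theta\mu_0I\|\le\gamma_2\theta\mu_0$. For $0<\epsilon<1$ let $N=(\log_2 n)\,n^2\lfloor\log_2(1/\epsilon)\rfloor$, $\vartheta_k=\min\bigl(1,\frac1{\log_2 n\,\log_2(1/\epsilon)}\bigr)$ for $k<N$, $\vartheta_k=(k+1-N)^{-1.1}$ for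 $k\ge N$, and $\bar\vartheta=\sum_k\vartheta_k$. Fix $0<\hat\vartheta\le\sigma_{\min}(\mathcal A)$. Iteration $k$ of the inexact-infeasible method computes symmetric $\Delta X_k,\Delta S_k$ and $\Delta y_k$, approximately solving the Newton system $$\mathcal A^{\top}\Delta y+\Delta S=-\eta_1(R_k^d+r^d),\quad \mathcal A\,\Delta X=-\eta_1(R_k^p+r^p),\quad H_P(X_k\Delta S+\Delta X\,S_k)=(1-\eta_2)\theta_k\mu_0I-H_P(X_kS_k)+r^c,$$ where $R_k^d,R_k^p$ are the residuals at the iterate $k$ and $r^d=r^p=r^c=0$ for the exact system. It then takes the largest $\alpha_k\in[0,\min(1,\frac1{\eta_1(1+\bar\vartheta)})]$ for which the point $\bigl((1-\alpha\eta_1)\tau_k,(1-\alpha\eta_2)\theta_k,X_k+\alpha\Delta X_k,y_k+\alpha\Delta y_k,S_k+\alpha\Delta S_k\bigr)$ lies in $\mathcal N_I$, and moves to that point. The direction is an inexact search direction if it solves the system with residuals $$\|r^d\|\le B_d:=\gamma_1\rho\tau_k\vartheta_k,\quad \|r^p\|\le B_p:=\hat\vartheta\gamma_1\rho\tau_k\vartheta_k,\quad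 \|r^c\|\le B_c:=\tfrac12(1-\eta_2)\gamma_2\theta_k\mu_0. \qquad(*)$$ In the quantum method it is a tomography estimate $d_k$ of an exact solution $u_k$, with $\|u_k\|\le\varrho$ and relative error $\|d_k-u_k\|\le\xi_k\|u_k\|$, where the tomography error is prescribed by $\xi_k\le\frac1{\varrho L_k}\min\{\eta_1B_d,\eta_1B_p,B_c\}$; here $\varrho>0$, and $L_k>0$ is any bound for the operator norm of the Newton matrix at iteration $k$ (for the norm $\|(U,v,W)\|^2=\|U\|^2+\|v\|^2+\|W\|^2$). **Theorem.** There is a constant $K>0$, depending only on $\gamma_1,\gamma_2,\eta_1,\eta_2$, such that for all such problems and starting points, all $0<\epsilon<1$ and every $k\ge K\,n^2\ln(1/\epsilon)$: after $k$ iterations of the method one has $\theta_k\le\epsilon$, and hence $\tau_k\le\epsilon$. This holds whenever in each of these iterations the direction is an inexact search direction, i.e. satisfies $(*)$, and also whenever it is a tomography estimate with the prescribed error $\xi_k$. -/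

import Mathlib

open scoped MatrixOrder

/-! Throughout, `‖·‖` is the Frobenius norm on matrices and the Euclidean norm on vectors. -/

attribute [local instance] Matrix.frobeniusNormedAddCommGroup Matrix.frobeniusNormedSpace

noncomputable section

namespace SDO

/-- Real square matrices of order `n`. -/
abbrev Mat (n : ℕ) := Matrix (Fin n) (Fin n) ℝ

/-- Euclidean space `ℝ^m`. -/
abbrev Vec (m : ℕ) := EuclideanSpace ℝ (Fin m)

/-- The data of the primal-dual pair
`min {C • X : A⁽ⁱ⁾ • X = bᵢ, X ⪰ 0}` and `max {bᵀ y : ∑ yᵢ A⁽ⁱ⁾ + S = C, S ⪰ 0}`,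
with symmetric, linearly independent `A⁽ⁱ⁾`. -/
structure Problem (m n : ℕ) where
  A : Fin m → Mat n
  b : Vec m
  C : Mat n
  A_symm : ∀ i, (A i).IsSymm
  C_symm : C.IsSymm
  A_indep : LinearIndependent ℝ A

variable {m n : ℕ}

/-- `𝒜 vec(X)`, the vector with entries `A⁽ⁱ⁾ • X`. -/
def Problem.op (P : Problem m n) (X : Mat n) : Vec m :=
  WithLp.toLp 2 fun i => (P.A i * X).trace

/-- `𝒜ᵀ y`, as a matrix: `∑ᵢ yᵢ A⁽ⁱ⁾`. -/
def Problem.adj (P : Problem m n) (y : Vec m) : Mat n := ∑ i, y i • P.A i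

/-- `𝒜 𝒜ᵀ`, the Gram matrix of the `A⁽ⁱ⁾` (invertible, as these are linearly independent). -/
def Problem.gram (P : Problem m n) : Matrix (Fin m) (Fin m) ℝ :=
  Matrix.of fun i j => (P.A i * P.A j).trace

/-- `𝒜⁺ v = 𝒜ᵀ (𝒜 𝒜ᵀ)⁻¹ v`, as a matrix. -/
def Problem.pinv (P : Problem m n) (v : Vec m) : Mat n :=
  P.adj (WithLp.toLp 2 (P.gram⁻¹.mulVec v.ofLp))

/-- `R^p = 𝒜 vec(X) - b`. -/
def Problem.primalRes (P : Problem m n) (X : Mat n) : Vec m := P.op X - P.b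

/-- `R^d = 𝒜ᵀ y + S - C`, as a matrix. -/
def Problem.dualRes (P : Problem m n) (y : Vec m) (S : Mat n) : Mat n := P.adj y + S - P.C

/-- `(X, y, S)` is primal-dual optimal: both parts are feasible and the duality gap is zero. -/
def Problem.IsOptimal (P : Problem m n) (X : Mat n) (y : Vec m) (S : Mat n) : Prop :=
  X.PosSemidef ∧ P.op X = P.b ∧ S.PosSemidef ∧ P.adj y + S = P.C ∧
    (P.C * X).trace = ∑ i, P.b i * y i

/-- The symmetrization `H_Q(M) = (Q M Q⁻¹ + Q⁻ᵀ Mᵀ Qᵀ) / 2`. -/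
def symmetrize (Q M : Mat n) : Mat n :=
  (1 / 2 : ℝ) • (Q * M * Q⁻¹ + Q⁻¹.transpose * M.transpose * Q.transpose)

/-- `H_P` for the HKM choice `P = S^{1/2}`. -/
def hkm (S M : Mat n) : Mat n := symmetrize (CFC.sqrt S) M

/-- The parameters of the method. -/
structure Params where
  γ₁ : ℝ
  γ₂ : ℝ
  η₁ : ℝ
  η₂ : ℝ
  γ₁_mem : γ₁ ∈ Set.Ioo (0 : ℝ) 1
  γ₂_mem : γ₂ ∈ Set.Ioo (0 : ℝ) 1
  η₁_mem : η₁ ∈ Set.Ioc (0 : ℝ) 1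
  η₂_mem : η₂ ∈ Set.Ioo (0 : ℝ) 1
  η₂_le : η₂ ≤ η₁

/-- An iterate `(τ, θ, X, y, S)`. -/
structure Iterate (m n : ℕ) where
  τ : ℝ
  θ : ℝ
  X : Mat n
  y : Vec m
  S : Mat n

/-- The starting point `τ₀ = θ₀ = 1`, `X₀ = S₀ = ρ I`, with any `y₀`; it need not be feasible. -/
def start (n : ℕ) (ρ : ℝ) (y₀ : Vec m) : Iterate m n where
  τ := 1
  θ := 1
  X := ρ • 1
  y := y₀
  S := ρ • 1

/-- The neighbourhood `𝒩_I` of the infeasible central path belonging to the starting point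
`start n ρ y₀`, for which `μ₀ = X₀ • S₀ / n = ρ²`. Positive definiteness of `S` is what makes the
scaling `S^{1/2}` invertible; for `θ > 0` the last condition then forces `X` to be positive definite
as well. -/
def neighborhood (P : Problem m n) (p : Params) (ρ : ℝ) (y₀ : Vec m) : Set (Iterate m n) :=
  {z | 0 ≤ z.τ ∧ z.τ ≤ z.θ ∧ z.X.PosSemidef ∧ z.S.PosDef ∧
    (∃ ζd : Mat n, ‖ζd‖ ≤ p.γ₁ * ρ ∧
      P.dualRes z.y z.S = z.τ • (P.dualRes y₀ (ρ • 1) + ζd)) ∧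
    (∃ ζp : Vec m, ‖P.pinv ζp‖ ≤ p.γ₁ * ρ ∧
      P.primalRes z.X = z.τ • (P.primalRes (ρ • 1) + ζp)) ∧
    ‖hkm z.S (z.X * z.S) - (z.θ * ρ ^ 2) • (1 : Mat n)‖ ≤ p.γ₂ * (z.θ * ρ ^ 2)}

/-- Triples `(ΔX, Δy, ΔS)`, and also triples of block rows of the Newton system (dual feasibility,
primal feasibility, complementarity). -/
abbrev Triple (m n : ℕ) := Mat n × Vec m × Mat n

/-- The Euclidean norm of `svec(U) ∘ v ∘ svec(W)`. -/
def Triple.norm (d : Triple m n) : ℝ := Real.sqrt (‖d.1‖ ^ 2 + ‖d.2.1‖ ^ 2 + ‖d.2.2‖ ^ 2)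

/-- Both matrices of the triple are symmetric. -/
def Triple.IsSymm (d : Triple m n) : Prop := d.1.IsSymm ∧ d.2.2.IsSymm

/-- The Newton operator with the HKM direction,
`(ΔX, Δy, ΔS) ↦ (𝒜ᵀ Δy + ΔS, 𝒜 ΔX, H_P(X ΔS + ΔX S))`. -/
def Problem.newton (P : Problem m n) (z : Iterate m n) (d : Triple m n) : Triple m n :=
  (P.adj d.2.1 + d.2.2, P.op d.1, hkm z.S (z.X * d.2.2 + d.1 * z.S))

/-- The right-hand side of the Newton system with residuals `(r^d, r^p, r^c)`:
`(-η₁ (R^d + r^d), -η₁ (R^p + r^p), (1 - η₂) θ μ₀ I - H_P(X S) + r^c)`. -/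
def Problem.newtonRhs (P : Problem m n) (p : Params) (ρ : ℝ) (z : Iterate m n)
    (r : Triple m n) : Triple m n :=
  (-(p.η₁ • (P.dualRes z.y z.S + r.1)),
    -(p.η₁ • (P.primalRes z.X + r.2.1)),
    ((1 - p.η₂) * z.θ * ρ ^ 2) • (1 : Mat n) - hkm z.S (z.X * z.S) + r.2.2)

/-- The admissible size of `r^d`. -/
def dualTol (p : Params) (ρ ϑ : ℝ) (z : Iterate m n) : ℝ := p.γ₁ * ρ * z.τ * ϑ

/-- The admissible size of `r^p`. -/
def primalTol (p : Params) (ρ ϑhat ϑ : ℝ) (z : Iterate m n) : ℝ := ϑhat * (p.γ₁ * ρ * z.τ * ϑ)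

/-- The admissible size of `r^c`. -/
def complTol (p : Params) (ρ : ℝ) (z : Iterate m n) : ℝ :=
  1 / 2 * (1 - p.η₂) * p.γ₂ * z.θ * ρ ^ 2

/-- `d` is an inexact search direction at `z`: a symmetric solution of the Newton system with
residuals of admissible size. -/
def IsInexactDirection (P : Problem m n) (p : Params) (ρ ϑhat ϑ : ℝ) (z : Iterate m n)
    (d : Triple m n) : Prop :=
  d.IsSymm ∧ ∃ r : Triple m n, P.newton z d = P.newtonRhs p ρ z r ∧
    ‖r.1‖ ≤ dualTol p ρ ϑ z ∧ ‖r.2.1‖ ≤ primalTol p ρ ϑhat ϑ z ∧ ‖r.2.2‖ ≤ complTol p ρ z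

/-- `d` is a classical estimate, obtained by tomography with error `ξ`, of an exact solution `u` of
the Newton system with `‖u‖ ≤ ϱ`. The tomography error is relative: it refers to the normalized
solution `u / ‖u‖`. -/
def IsTomographyEstimate (P : Problem m n) (p : Params) (ρ ϱ ξ : ℝ) (z : Iterate m n)
    (d : Triple m n) : Prop :=
  d.IsSymm ∧ ∃ u : Triple m n, u.IsSymm ∧ P.newton z u = P.newtonRhs p ρ z 0 ∧
    u.norm ≤ ϱ ∧ Triple.norm (d - u) ≤ ξ * u.norm

/-- The prescribed tomography error `ξ`: it is at most `1 / (ϱ L)` times the least of the admissible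
sizes of the residual terms `η₁ r^d`, `η₁ r^p`, `r^c` of the Newton system. Here `L` is the factor
that normalizes the Newton system, i.e. a bound for the operator norm of its matrix. -/
def IsPrescribedError (P : Problem m n) (p : Params) (ρ ϑhat ϑ ϱ L ξ : ℝ)
    (z : Iterate m n) : Prop :=
  (∀ v : Triple m n, v.IsSymm → (P.newton z v).norm ≤ L * v.norm) ∧
    ξ ≤ 1 / (ϱ * L) *
      min (p.η₁ * dualTol p ρ ϑ z) (min (p.η₁ * primalTol p ρ ϑhat ϑ z) (complTol p ρ z))

/-- The number `N = (log n) n² ⌊log (1/ε)⌋`; logarithms are to base 2. -/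
def switchIndex (n : ℕ) (ε : ℝ) : ℝ :=
  Real.logb 2 n * (n : ℝ) ^ 2 * (⌊Real.logb 2 (1 / ε)⌋ : ℝ)

open Classical in
/-- The prescribed sequence `ϑₖ`. -/
def vartheta (n : ℕ) (ε : ℝ) (k : ℕ) : ℝ :=
  if (k : ℝ) < switchIndex n ε then
    min 1 (1 / (Real.logb 2 n * Real.logb 2 (1 / ε)))
  else 1 / ((k : ℝ) + 1 - switchIndex n ε) ^ (1.1 : ℝ)

/-- The point reached from `z` along `d` with step length `a`. -/
def move (p : Params) (z : Iterate m n) (d : Triple m n) (a : ℝ) : Iterate m n where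
  τ := (1 - a * p.η₁) * z.τ
  θ := (1 - a * p.η₂) * z.θ
  X := z.X + a • d.1
  y := z.y + a • d.2.1
  S := z.S + a • d.2.2

/-- `z 0, …, z k` are iterates of the inexact-infeasible interior point method, with the prescribed
sequence `ϑ`, when the `i`-th search direction is subject to the condition `dir i`: the step length
is the largest one in `[0, min(1, 1 / (η₁ (1 + ∑ ϑᵢ)))]` that leads to a point of `𝒩_I`. -/
def IsRun (P : Problem m n) (p : Params) (ρ : ℝ) (y₀ : Vec m) (ε : ℝ)
    (dir : ℕ → Iterate m n → Triple m n → Prop) (k : ℕ) (z : ℕ → Iterate m n) : Prop :=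
  z 0 = start n ρ y₀ ∧
    ∀ i < k, ∃ (d : Triple m n) (α : ℝ), dir i (z i) d ∧
      IsGreatest {a : ℝ | a ∈ Set.Icc 0 (min 1 (1 / (p.η₁ * (1 + ∑' j, vartheta n ε j)))) ∧
        move p (z i) d a ∈ neighborhood P p ρ y₀} α ∧
      z (i + 1) = move p (z i) d α

end SDO

end

/-! Each step multiplies `θ` by `1 - α η₂`, and `τ ≤ θ` on the neighbourhood. So it suffices that
every step length satisfies `α ≥ c / n²` with `c` depending on the parameters only; then `(1 - c η₂
/ n²)^k ≤ exp (-c η₂ k / n²) ≤ ε`. As `α` is the greatest admissible step, it suffices to show that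
`c / n²` is admissible.

Put `T = S^{1/2}`, `M = T X T`, `μ = θ μ₀`, and scale the directions to `T ΔX T` and `T⁻¹ ΔS T⁻¹`.
Then `M` is within `γ₂ μ` of `μ I`, and a step changes the centrality defect linearly up to a term
`α² ‖T ΔX T‖ ‖T⁻¹ ΔS T⁻¹‖`. The factors are at most of order `n μ` and `n`
(`IsInexactDirection.norm_le`), so a step of order `n⁻²` absorbs this term
(`norm_symmPart_step_le`). The symmetrization belonging to the new `S` can only reduce the defect
(`norm_hkm_mul_self_sub_le`).

For infeasible iterates `ΔX` and `ΔS` are not orthogonal. Comparison with an optimal solution gives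
explicit shifts that put `ΔX` into the kernel of `𝒜` and `ΔS` into the range of `𝒜ᵀ`. The scaled
shifts are controlled by `ρ τ (tr X + tr S)`, which is of order `n μ` by `trace_add_trace_le`.

The inexact residuals accumulate. Since `α η₁ (1 + ∑ ϑ) ≤ 1`, step `i` adds at most the fraction `ϑᵢ
/ ∑ ϑ` of the allowance `γ₁ ρ` (`Tracked.move`), so the allowance is never exceeded. As `∑ ϑ` is of
order `n²` uniformly in `ε` (`tsum_vartheta_le`), this cap is compatible with `c / n²`. Tomography
estimates reduce to inexact directions because the Newton operator is additive and bounded by `L`.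
-/

namespace SDO

open Matrix

variable {m n : ℕ}

/-! ### Frobenius norm, trace and positive semidefiniteness -/

section Frobenius

theorem isSymm_of_posSemidef {A : Mat n} (hA : A.PosSemidef) : A.IsSymm := by
  have h := hA.isHermitian
  rwa [IsHermitian, conjTranspose_eq_transpose_of_trivial] at h

theorem sqrt_transpose (S : Mat n) : (CFC.sqrt S)ᵀ = CFC.sqrt S :=
  isSymm_of_posSemidef (nonneg_iff_posSemidef.1 (CFC.sqrt_nonneg S))

theorem sqrt_mul_sqrt {S : Mat n} (hS : S.PosSemidef) : CFC.sqrt S * CFC.sqrt S = S :=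
  CFC.sqrt_mul_sqrt_self S (nonneg_iff_posSemidef.2 hS)

theorem norm_sq_eq_sum (A : Mat n) : ‖A‖ ^ 2 = ∑ i, ∑ j, A i j ^ 2 := by
  rw [frobenius_norm_def, ← Real.sqrt_eq_rpow, Real.sq_sqrt (by positivity)]
  simp

theorem norm_sq_eq_trace (A : Mat n) : ‖A‖ ^ 2 = (Aᵀ * A).trace := by
  rw [norm_sq_eq_sum, Finset.sum_comm]
  simp [trace, mul_apply, sq]

theorem trace_mul_le (A B : Mat n) : (A * B).trace ≤ ‖A‖ * ‖B‖ := by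
  refine le_of_sq_le_sq ?_ (by positivity)
  rw [mul_pow, ← frobenius_norm_transpose B, norm_sq_eq_sum, norm_sq_eq_sum]
  simp only [← Finset.sum_product', Finset.univ_product_univ, trace, diag_apply, mul_apply,
    transpose_apply]
  exact Finset.sum_mul_sq_le_sq_mul_sq _ _ _

theorem neg_le_trace_mul (A B : Mat n) : -(‖A‖ * ‖B‖) ≤ (A * B).trace := by
  have := trace_mul_le (-A) B
  rw [norm_neg, Matrix.neg_mul, trace_neg] at this
  linarith

theorem norm_le_trace_of_posSemidef {A : Mat n} (hA : A.PosSemidef) : ‖A‖ ≤ A.trace := by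
  have h : A = (CFC.sqrt A)ᵀ * CFC.sqrt A := by rw [sqrt_transpose, sqrt_mul_sqrt hA]
  rw [h, ← norm_sq_eq_trace, sq]
  exact (frobenius_norm_mul _ _).trans_eq (by rw [frobenius_norm_transpose])

theorem trace_mul_nonneg {A B : Mat n} (hA : A.PosSemidef) (hB : B.PosSemidef) :
    0 ≤ (A * B).trace := by
  have h := (hB.mul_mul_conjTranspose_same (CFC.sqrt A)).trace_nonneg
  rwa [conjTranspose_eq_transpose_of_trivial, sqrt_transpose, trace_mul_comm, ← Matrix.mul_assoc,
    sqrt_mul_sqrt hA] at h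

theorem norm_one_sq : ‖(1 : Mat n)‖ ^ 2 = n := by
  rw [norm_sq_eq_trace]; simp

theorem norm_one_le (hn : 1 ≤ n) : ‖(1 : Mat n)‖ ≤ n := by
  have h : (1 : ℝ) ≤ n := by exact_mod_cast hn
  refine le_of_sq_le_sq ?_ (by positivity)
  rw [norm_one_sq]; nlinarith

theorem trace_le_norm (hn : 1 ≤ n) (A : Mat n) : A.trace ≤ n * ‖A‖ := by
  have := trace_mul_le 1 A
  rw [one_mul] at this
  exact this.trans (mul_le_mul_of_nonneg_right (norm_one_le hn) (norm_nonneg _))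

/-- The quadratic form is the trace of `M` against `x xᵀ`, whose Frobenius norm is at most its trace
`x ⬝ᵥ x`. -/
theorem neg_le_dotProduct_mulVec (M : Mat n) (x : Fin n → ℝ) :
    -(‖M‖ * (x ⬝ᵥ x)) ≤ x ⬝ᵥ (M *ᵥ x) := by
  have h1 : ‖vecMulVec x x‖ ≤ x ⬝ᵥ x := by
    have := norm_le_trace_of_posSemidef (posSemidef_vecMulVec_self_star x)
    simpa [trace_vecMulVec] using this
  have h2 : (M * vecMulVec x x).trace = x ⬝ᵥ (M *ᵥ x) := by
    rw [mul_vecMulVec, trace_vecMulVec, dotProduct_comm]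
  rw [← h2]
  have := neg_le_trace_mul M (vecMulVec x x)
  nlinarith [mul_le_mul_of_nonneg_left h1 (norm_nonneg M)]

theorem posSemidef_smul_one_add {c : ℝ} {M : Mat n} (hM : M.IsSymm) (h : ‖M‖ ≤ c) :
    (c • (1 : Mat n) + M).PosSemidef := by
  refine PosSemidef.of_dotProduct_mulVec_nonneg ?_ fun x => ?_
  · simp [IsHermitian, conjTranspose_eq_transpose_of_trivial, hM.eq]
  · have h0 : 0 ≤ x ⬝ᵥ x := by simpa using dotProduct_star_self_nonneg x
    simp only [star_trivial, add_mulVec, dotProduct_add, smul_mulVec, one_mulVec, dotProduct_smul,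
      smul_eq_mul]
    nlinarith [neg_le_dotProduct_mulVec M x, mul_le_mul_of_nonneg_right h h0]

theorem posDef_smul_one_add {c : ℝ} {M : Mat n} (hM : M.IsSymm) (h : ‖M‖ < c) :
    (c • (1 : Mat n) + M).PosDef := by
  have : c • (1 : Mat n) + M = (c - ‖M‖) • (1 : Mat n) + (‖M‖ • (1 : Mat n) + M) := by
    rw [sub_smul]; abel
  rw [this]
  exact (PosDef.one.smul (sub_pos.2 h)).add_posSemidef (posSemidef_smul_one_add hM le_rfl)

/-- The right side equals `(tr (B B) + ‖B‖²) / 2`, and `tr (B B) ≤ ‖B‖²` by Cauchy–Schwarz. -/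
theorem trace_sq_le_norm_symm_sq (B : Mat n) : (B * B).trace ≤ ‖(1 / 2 : ℝ) • (B + Bᵀ)‖ ^ 2 := by
  have h1 := norm_sq_eq_trace B
  have h2 := trace_mul_le B B
  have h3 : (Bᵀ * Bᵀ).trace = (B * B).trace := by rw [← transpose_mul, trace_transpose]
  have h4 : (B * Bᵀ).trace = (Bᵀ * B).trace := trace_mul_comm _ _
  rw [norm_sq_eq_trace]
  simp only [transpose_smul, transpose_add, transpose_transpose, Matrix.smul_mul, Matrix.mul_smul,
    trace_smul, smul_eq_mul, Matrix.add_mul, Matrix.mul_add, trace_add]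
  nlinarith

theorem norm_half_add_le {A B : Mat n} {c : ℝ} (hA : ‖A‖ ≤ c) (hB : ‖B‖ ≤ c) :
    ‖(1 / 2 : ℝ) • (A + B)‖ ≤ c := by
  rw [norm_smul, Real.norm_of_nonneg (by norm_num)]
  linarith [norm_add_le A B]

end Frobenius

/-! ### The HKM symmetrization -/

section Hkm

variable {S : Mat n}

theorem isUnit_det_sqrt (hS : S.PosDef) : IsUnit (CFC.sqrt S).det := by
  have h := (isUnit_iff_isUnit_det S).1 hS.isUnit
  rw [← sqrt_mul_sqrt hS.posSemidef, det_mul] at h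
  exact isUnit_of_mul_isUnit_left h

theorem hkm_eq (S M : Mat n) : hkm S M = (1 / 2 : ℝ) •
    (CFC.sqrt S * M * (CFC.sqrt S)⁻¹ + (CFC.sqrt S * M * (CFC.sqrt S)⁻¹)ᵀ) := by
  simp only [hkm, symmetrize, transpose_mul, Matrix.mul_assoc]

theorem hkm_add (S M N : Mat n) : hkm S (M + N) = hkm S M + hkm S N := by
  simp only [hkm_eq, Matrix.mul_add, Matrix.add_mul, transpose_add, smul_add]; abel

theorem hkm_mul_self (hS : S.PosDef) {X : Mat n} (hX : X.IsSymm) :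
    hkm S (X * S) = CFC.sqrt S * X * CFC.sqrt S := by
  have h : CFC.sqrt S * (X * S) * (CFC.sqrt S)⁻¹ = CFC.sqrt S * X * CFC.sqrt S := by
    conv_lhs => rw [← sqrt_mul_sqrt hS.posSemidef]
    rw [sqrt_mul_sqrt hS.posSemidef]
    conv_lhs => enter [1, 2, 2]; rw [← sqrt_mul_sqrt hS.posSemidef]
    rw [← Matrix.mul_assoc, ← Matrix.mul_assoc, mul_nonsing_inv_cancel_right _ _ (isUnit_det_sqrt hS)]
  rw [hkm_eq, h]
  simp only [transpose_mul, sqrt_transpose, hX.eq, Matrix.mul_assoc]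
  rw [← two_smul ℝ, smul_smul]; norm_num

end Hkm

/-! ### Symmetric parts and change of the scaling matrix -/

section SymmPart

/-- The symmetric part of a matrix. -/
noncomputable def symmPart : Mat n →ₗ[ℝ] Mat n where
  toFun Y := (1 / 2 : ℝ) • (Y + Yᵀ)
  map_add' Y Z := by rw [transpose_add, ← smul_add]; congr 1; abel
  map_smul' c Y := by simp only [transpose_smul, ← smul_add, smul_smul, RingHom.id_apply, mul_comm]

theorem symmPart_apply (Y : Mat n) : symmPart Y = (1 / 2 : ℝ) • (Y + Yᵀ) := rfl

theorem symmPart_of_isSymm {Y : Mat n} (hY : Y.IsSymm) : symmPart Y = Y := by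
  rw [symmPart_apply, hY.eq, ← two_smul ℝ, smul_smul]; norm_num

theorem symmPart_smul_one (c : ℝ) : symmPart (c • (1 : Mat n)) = c • 1 :=
  symmPart_of_isSymm (by simp [IsSymm])

theorem norm_symmPart_le (Y : Mat n) : ‖symmPart Y‖ ≤ ‖Y‖ :=
  norm_half_add_le le_rfl (frobenius_norm_transpose Y).le

theorem trace_symmPart_mul (Y : Mat n) {E : Mat n} (hE : E.IsSymm) :
    (symmPart Y * E).trace = (Y * E).trace := by
  have h : (Yᵀ * E).trace = (Y * E).trace := by
    rw [← trace_transpose, transpose_mul, transpose_transpose, hE.eq, trace_mul_comm]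
  rw [symmPart_apply, Matrix.smul_mul, trace_smul, Matrix.add_mul, trace_add, h, smul_eq_mul]
  ring

theorem trace_sq_le_norm_symmPart_sq (B : Mat n) : (B * B).trace ≤ ‖symmPart B‖ ^ 2 :=
  trace_sq_le_norm_symm_sq B

theorem hkm_eq_symmPart (S M : Mat n) :
    hkm S M = symmPart (CFC.sqrt S * M * (CFC.sqrt S)⁻¹) := hkm_eq S M

/-- The symmetrization by the current `S` minimizes the distance to multiples of the identity. -/
theorem norm_hkm_mul_self_sub_le {S S' X : Mat n} (hS : S.PosDef) (hS' : S'.PosDef)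
    (hX : X.IsSymm) (c : ℝ) :
    ‖hkm S' (X * S') - c • (1 : Mat n)‖ ≤ ‖hkm S (X * S') - c • (1 : Mat n)‖ := by
  have conj : ∀ {R : Mat n}, R.PosDef → ∀ Y : Mat n,
      CFC.sqrt R * Y * (CFC.sqrt R)⁻¹ - c • (1 : Mat n) =
        CFC.sqrt R * (Y - c • (1 : Mat n)) * (CFC.sqrt R)⁻¹ := fun hR Y => by
    rw [Matrix.mul_sub, Matrix.sub_mul, Matrix.mul_smul, Matrix.smul_mul, Matrix.mul_one,
      mul_nonsing_inv _ (isUnit_det_sqrt hR)]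
  have tr : ∀ {R : Mat n} (_ : R.PosDef), ∀ Y : Mat n,
      ((CFC.sqrt R * Y * (CFC.sqrt R)⁻¹) * (CFC.sqrt R * Y * (CFC.sqrt R)⁻¹)).trace =
        (Y * Y).trace := fun {R} hR Y => by
    have h : (CFC.sqrt R * Y * (CFC.sqrt R)⁻¹) * (CFC.sqrt R * Y * (CFC.sqrt R)⁻¹) =
        CFC.sqrt R * (Y * Y) * (CFC.sqrt R)⁻¹ := by
      simp only [Matrix.mul_assoc]
      rw [nonsing_inv_mul_cancel_left _ _ (isUnit_det_sqrt hR)]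
    rw [h, trace_mul_comm, nonsing_inv_mul_cancel_left _ _ (isUnit_det_sqrt hR)]
  have sub : ∀ {R : Mat n}, R.PosDef → ∀ Y : Mat n, hkm R Y - c • (1 : Mat n) =
      symmPart (CFC.sqrt R * (Y - c • (1 : Mat n)) * (CFC.sqrt R)⁻¹) := fun hR Y => by
    rw [← conj hR, map_sub, symmPart_smul_one, hkm_eq_symmPart]
  have hsymm : (hkm S' (X * S') - c • (1 : Mat n)).IsSymm := by
    rw [hkm_mul_self hS' hX]
    simp [IsSymm, sqrt_transpose, hX.eq, Matrix.mul_assoc]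
  have hB : hkm S' (X * S') - c • (1 : Mat n) =
      CFC.sqrt S' * (X * S' - c • (1 : Mat n)) * (CFC.sqrt S')⁻¹ := by
    have h : CFC.sqrt S' * X * CFC.sqrt S' = CFC.sqrt S' * (X * S') * (CFC.sqrt S')⁻¹ := by
      conv_rhs => enter [1, 2, 2]; rw [← sqrt_mul_sqrt hS'.posSemidef]
      rw [← Matrix.mul_assoc, ← Matrix.mul_assoc,
        mul_nonsing_inv_cancel_right _ _ (isUnit_det_sqrt hS')]
    rw [← conj hS', hkm_mul_self hS' hX, h]
  -- The matrix on the left is symmetric and similar to `X S' - c I`, so its squared norm is the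
  -- trace of the square, a similarity invariant. Computed in the scaling by `S`, that trace is at
  -- most the squared norm of the symmetric part.
  refine le_of_sq_le_sq ?_ (norm_nonneg _)
  rw [norm_sq_eq_trace, hsymm.eq, hB, tr hS', sub hS, ← tr hS]
  exact trace_sq_le_norm_symmPart_sq _

end SymmPart

/-! ### Estimates in scaled variables -/

section Scaled

variable {M dX dS R : Mat n} {μ γ : ℝ}

theorem norm_mul_le_of_near (hM : ‖M - μ • (1 : Mat n)‖ ≤ γ * μ) (hμ : 0 ≤ μ) (b : Mat n) :
    ‖M * b‖ ≤ (1 + γ) * μ * ‖b‖ := by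
  have h : M * b = μ • b + (M - μ • (1 : Mat n)) * b := by
    rw [Matrix.sub_mul, Matrix.smul_mul, Matrix.one_mul]; abel
  rw [h]
  refine (norm_add_le _ _).trans ?_
  rw [norm_smul, Real.norm_of_nonneg hμ]
  have := (frobenius_norm_mul (M - μ • (1 : Mat n)) b).trans
    (mul_le_mul_of_nonneg_right hM (norm_nonneg _))
  linarith

/-- The bound for the scaled dual direction, up to the shift `b` that makes the shifted
directions orthogonal. -/
theorem norm_add_shift_le (hμ : 0 < μ) (hγ : 0 ≤ γ) (hM : ‖M - μ • (1 : Mat n)‖ ≤ γ * μ)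
    {a b : Mat n} (horth : ((dX + a) * (dS + b)).trace = 0) (hE : (dS + b).IsSymm)
    (hN : symmPart (M * dS + dX) = R) :
    (1 - γ) * μ * ‖dS + b‖ ≤ ‖R‖ + ‖a‖ + (1 + γ) * μ * ‖b‖ := by
  -- Test the complementarity equation against `E = dS + b`: orthogonality removes `dX + a`, and
  -- what remains is the form `tr (M E E) ≥ (1 - γ) μ ‖E‖²` and two terms linear in the shifts.
  have hR : (R * (dS + b)).trace =
      (M * ((dS + b) * (dS + b))).trace - (M * b * (dS + b)).trace - (a * (dS + b)).trace := by
    have e : (M * dS + dX) * (dS + b) =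
        M * ((dS + b) * (dS + b)) - M * b * (dS + b) - a * (dS + b) + (dX + a) * (dS + b) := by
      noncomm_ring
    rw [← hN, trace_symmPart_mul _ hE, e, trace_add, horth, trace_sub, trace_sub, add_zero]
  generalize dS + b = E at *
  have h1 := trace_mul_le R E
  have h2 := trace_mul_le (M * b) E
  have h3 := trace_mul_le a E
  have h4 := neg_le_trace_mul (M - μ • (1 : Mat n)) (E * E)
  have h5 : ((M - μ • (1 : Mat n)) * (E * E)).trace = (M * (E * E)).trace - μ * ‖E‖ ^ 2 := by
    rw [norm_sq_eq_trace, hE.eq, Matrix.sub_mul, trace_sub, Matrix.smul_mul, trace_smul,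
      Matrix.one_mul, smul_eq_mul]
  have h6 := norm_mul_le_of_near hM hμ.le b
  have h7 : ‖M - μ • (1 : Mat n)‖ * ‖E * E‖ ≤ γ * μ * (‖E‖ * ‖E‖) :=
    mul_le_mul hM (frobenius_norm_mul _ _) (norm_nonneg _) (by positivity)
  have h8 := mul_le_mul_of_nonneg_right h6 (norm_nonneg E)
  rcases (norm_nonneg E).eq_or_lt with h0 | h0
  · rw [← h0, mul_zero]; positivity
  · refine le_of_mul_le_mul_right ?_ h0
    linarith

theorem norm_primal_le (hμ : 0 < μ) (hM : ‖M - μ • (1 : Mat n)‖ ≤ γ * μ)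
    (hdX : dX.IsSymm) (hN : symmPart (M * dS + dX) = R) :
    ‖dX‖ ≤ ‖R‖ + (1 + γ) * μ * ‖dS‖ := by
  have h : dX = R - symmPart (M * dS) := by
    rw [← hN, map_add, symmPart_of_isSymm hdX]; abel
  rw [h]
  have := norm_symmPart_le (M * dS)
  have := norm_mul_le_of_near hM hμ.le dS
  linarith [norm_sub_le R (symmPart (M * dS))]

/-- The linear part of the defect is `(1 - α) (M - μ I)`, which leaves a slack of `α (1 - η) γ μ`.
The residual `r` uses one half of it and the quadratic term the other half. -/
theorem norm_symmPart_step_le (hM : ‖M - μ • (1 : Mat n)‖ ≤ γ * μ) (hMs : M.IsSymm)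
    {η α : ℝ} {r : Mat n}
    (hN : symmPart (M * dS + dX) = ((1 - η) * μ) • (1 : Mat n) - M + r)
    (hr : ‖r‖ ≤ 1 / 2 * (1 - η) * γ * μ) (hα0 : 0 ≤ α) (hα1 : α ≤ 1)
    (hα : α * (‖dX‖ * ‖dS‖) ≤ 1 / 2 * (1 - η) * γ * μ) :
    ‖symmPart ((M + α • dX) * (1 + α • dS)) - ((1 - α * η) * μ) • (1 : Mat n)‖ ≤
      γ * ((1 - α * η) * μ) := by
  have e : symmPart ((M + α • dX) * (1 + α • dS)) - ((1 - α * η) * μ) • (1 : Mat n) =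
      (1 - α) • (M - μ • (1 : Mat n)) + α • r + α ^ 2 • symmPart (dX * dS) := by
    have : (M + α • dX) * (1 + α • dS) = M + α • (M * dS + dX) + α ^ 2 • (dX * dS) := by
      simp only [Matrix.mul_add, Matrix.add_mul, Matrix.mul_one, Matrix.mul_smul,
        Matrix.smul_mul, smul_add, smul_smul, sq]
      abel
    rw [this, map_add, map_add, map_smul, map_smul, hN, symmPart_of_isSymm hMs]
    module
  have h1 := (norm_symmPart_le (dX * dS)).trans (frobenius_norm_mul dX dS)
  rw [e]
  refine (norm_add₃_le).trans ?_
  rw [norm_smul, norm_smul, norm_smul, Real.norm_of_nonneg (sub_nonneg.2 hα1),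
    Real.norm_of_nonneg hα0, Real.norm_of_nonneg (sq_nonneg α)]
  nlinarith [mul_le_mul_of_nonneg_left hM (sub_nonneg.2 hα1), mul_le_mul_of_nonneg_left hr hα0,
    mul_le_mul_of_nonneg_left h1 (sq_nonneg α), mul_le_mul_of_nonneg_left hα hα0]

end Scaled

/-! ### The constraint operator, its adjoint and pseudoinverse -/

section Operator

variable (P : Problem m n)

theorem Problem.op_add (X Y : Mat n) : P.op (X + Y) = P.op X + P.op Y := by
  ext i; simp [op, Matrix.mul_add]

theorem Problem.op_smul (c : ℝ) (X : Mat n) : P.op (c • X) = c • P.op X := by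
  ext i; simp [op]

theorem Problem.op_sub (X Y : Mat n) : P.op (X - Y) = P.op X - P.op Y := by
  ext i; simp [op, Matrix.mul_sub]

theorem Problem.adj_add (x y : Vec m) : P.adj (x + y) = P.adj x + P.adj y := by
  simp [adj, add_smul, Finset.sum_add_distrib]

theorem Problem.adj_smul (c : ℝ) (y : Vec m) : P.adj (c • y) = c • P.adj y := by
  simp [adj, Finset.smul_sum, smul_smul]

theorem Problem.adj_sub (x y : Vec m) : P.adj (x - y) = P.adj x - P.adj y := by
  simp [adj, sub_smul, Finset.sum_sub_distrib]

theorem Problem.adj_isSymm (y : Vec m) : (P.adj y).IsSymm := by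
  simp [IsSymm, adj, transpose_sum, fun i => (P.A_symm i).eq]

theorem Problem.trace_adj_mul (y : Vec m) (X : Mat n) :
    (P.adj y * X).trace = ∑ i, y i * P.op X i := by
  simp [adj, op, Finset.sum_mul, trace_sum]

theorem Problem.op_adj (y : Vec m) : P.op (P.adj y) = WithLp.toLp 2 (P.gram *ᵥ y.ofLp) := by
  ext i
  simp [op, adj, gram, mulVec, dotProduct, Finset.mul_sum, trace_sum, mul_comm]

theorem Problem.trace_mul_adj_eq_zero {X : Mat n} (hX : P.op X = 0) (y : Vec m) :
    (X * P.adj y).trace = 0 := by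
  rw [trace_mul_comm, trace_adj_mul, hX]; simp

theorem Problem.isUnit_det_gram : IsUnit P.gram.det := by
  rw [isUnit_iff_ne_zero]
  intro h
  obtain ⟨v, hv, hv0⟩ := exists_mulVec_eq_zero_iff.2 h
  have h1 : P.op (P.adj (WithLp.toLp 2 v)) = 0 := by rw [op_adj]; simp [hv0]
  have h2 := P.trace_mul_adj_eq_zero h1 (WithLp.toLp 2 v)
  have h3 : P.adj (WithLp.toLp 2 v) = 0 := by
    have := norm_sq_eq_trace (P.adj (WithLp.toLp 2 v))
    rw [(P.adj_isSymm _).eq, h2] at this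
    exact norm_eq_zero.1 (pow_eq_zero_iff (two_ne_zero) |>.1 this)
  exact hv (funext fun i => Fintype.linearIndependent_iff.1 P.A_indep v h3 i)

theorem Problem.op_pinv (v : Vec m) : P.op (P.pinv v) = v := by
  rw [pinv, op_adj]
  simp [mul_nonsing_inv _ P.isUnit_det_gram]

theorem Problem.pinv_add (v w : Vec m) : P.pinv (v + w) = P.pinv v + P.pinv w := by
  rw [pinv, pinv, pinv, ← adj_add]
  congr 1; ext i; simp [mulVec_add]

theorem Problem.pinv_smul (c : ℝ) (v : Vec m) : P.pinv (c • v) = c • P.pinv v := by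
  rw [pinv, pinv, ← adj_smul]
  congr 1; ext i; simp [mulVec_smul]

/-- With `w = (𝒜𝒜ᵀ)⁻¹ v` one has `‖𝒜ᵀ w‖² = ⟨w, v⟩ ≤ ‖w‖ ‖v‖`, and `ϑ ‖w‖ ≤ ‖𝒜ᵀ w‖`. This is how the
factor `ϑhat` in the tolerance for `r^p` cancels. -/
theorem Problem.norm_pinv_le {ϑ : ℝ} (hϑ0 : 0 < ϑ) (hϑ : ∀ v : Vec m, ϑ * ‖v‖ ≤ ‖P.adj v‖)
    (v : Vec m) : ϑ * ‖P.pinv v‖ ≤ ‖v‖ := by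
  set w : Vec m := WithLp.toLp 2 (P.gram⁻¹ *ᵥ v.ofLp) with hw
  have h1 : ‖P.adj w‖ ^ 2 = ∑ i, w i * v i := by
    rw [norm_sq_eq_trace, (P.adj_isSymm w).eq, trace_adj_mul]
    have : P.op (P.adj w) = v := P.op_pinv v
    rw [this]
  have h2 : ∑ i, w i * v i ≤ ‖w‖ * ‖v‖ := by
    have := real_inner_le_norm v w
    rw [PiLp.inner_apply] at this
    simpa [mul_comm] using this
  change ϑ * ‖P.adj w‖ ≤ ‖v‖
  rcases (norm_nonneg (P.adj w)).eq_or_lt with h0 | h0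
  · rw [← h0, mul_zero]; exact norm_nonneg _
  · refine le_of_mul_le_mul_right ?_ h0
    nlinarith [mul_le_mul_of_nonneg_right (hϑ w) (norm_nonneg v)]

end Operator

/-! ### From tomography error to Newton residuals -/

section Newton

theorem Problem.newton_add (P : Problem m n) (z : Iterate m n) (d e : Triple m n) :
    P.newton z (d + e) = P.newton z d + P.newton z e := by
  simp only [newton, Prod.fst_add, Prod.snd_add, adj_add, op_add, Prod.mk_add_mk, ← hkm_add]
  refine Prod.ext (by simp only; abel) (Prod.ext rfl ?_)
  simp only [Matrix.mul_add, Matrix.add_mul]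
  congr 1; abel

theorem Triple.norm_nonneg (d : Triple m n) : 0 ≤ d.norm := Real.sqrt_nonneg _

theorem Triple.norm_fst_le (d : Triple m n) : ‖d.1‖ ≤ d.norm :=
  Real.le_sqrt_of_sq_le (by nlinarith [sq_nonneg ‖d.2.1‖, sq_nonneg ‖d.2.2‖])

theorem Triple.norm_snd_le (d : Triple m n) : ‖d.2.1‖ ≤ d.norm :=
  Real.le_sqrt_of_sq_le (by nlinarith [sq_nonneg ‖d.1‖, sq_nonneg ‖d.2.2‖])

theorem Triple.norm_trd_le (d : Triple m n) : ‖d.2.2‖ ≤ d.norm :=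
  Real.le_sqrt_of_sq_le (by nlinarith [sq_nonneg ‖d.2.1‖, sq_nonneg ‖d.1‖])

/-- A tomography estimate with the prescribed error is an inexact search direction. -/
theorem IsTomographyEstimate.isInexactDirection {P : Problem m n} {p : Params}
    {ρ ϑhat ϑ ϱ L ξ : ℝ} {z : Iterate m n} {d : Triple m n} (hρ : 0 < ρ) (hϑhat : 0 < ϑhat)
    (hϑ : 0 ≤ ϑ) (hϱ : 0 < ϱ) (hL : 0 < L) (hτ : 0 ≤ z.τ) (hθ : 0 ≤ z.θ)
    (hξ : IsPrescribedError P p ρ ϑhat ϑ ϱ L ξ z) (hd : IsTomographyEstimate P p ρ ϱ ξ z d) :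
    IsInexactDirection P p ρ ϑhat ϑ z d := by
  obtain ⟨hds, u, hus, hu, huϱ, hdu⟩ := hd
  obtain ⟨hop, hξ⟩ := hξ
  obtain ⟨γ₁0, -⟩ := p.γ₁_mem
  obtain ⟨γ₂0, -⟩ := p.γ₂_mem
  obtain ⟨η₁0, -⟩ := p.η₁_mem
  obtain ⟨-, η₂1⟩ := p.η₂_mem
  have η₂1' : 0 < 1 - p.η₂ := sub_pos.2 η₂1
  set B := min (p.η₁ * dualTol p ρ ϑ z)
    (min (p.η₁ * primalTol p ρ ϑhat ϑ z) (complTol p ρ z)) with hB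
  have hB0 : 0 ≤ B := by
    refine le_min ?_ (le_min ?_ ?_) <;> simp only [dualTol, primalTol, complTol] <;> positivity
  have hsymm : Triple.IsSymm (d - u) := ⟨hds.1.sub hus.1, hds.2.sub hus.2⟩
  have hle : L * Triple.norm (d - u) ≤ B := by
    have h1 : ξ * u.norm ≤ 1 / (ϱ * L) * B * ϱ :=
      (mul_le_mul_of_nonneg_right hξ u.norm_nonneg).trans
        (mul_le_mul_of_nonneg_left huϱ (by positivity))
    have h2 : L * (1 / (ϱ * L) * B * ϱ) = B := by field_simp
    rw [← h2]
    exact mul_le_mul_of_nonneg_left (hdu.trans h1) hL.le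
  have hle' := (hop _ hsymm).trans hle
  set e := P.newton z (d - u) with he
  have hde : P.newton z d = P.newtonRhs p ρ z 0 + e := by
    rw [← hu, he, ← Problem.newton_add, add_sub_cancel]
  have e1 := e.norm_fst_le.trans hle'
  have e2 := e.norm_snd_le.trans hle'
  have e3 := e.norm_trd_le.trans hle'
  -- The image `e` of the error `d - u` is the residual. The first two components are rescaled
  -- because `r^d` and `r^p` enter the right-hand side with the factor `-η₁`.
  refine ⟨hds, (-(p.η₁⁻¹ • e.1), -(p.η₁⁻¹ • e.2.1), e.2.2), ?_, ?_, ?_, ?_⟩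
  · rw [hde]
    simp only [Problem.newtonRhs]
    refine Prod.ext ?_ (Prod.ext ?_ ?_)
    · simp [smul_smul, η₁0.ne', add_comm]
    · simp [smul_smul, η₁0.ne', add_comm]
    · simp
  · rw [norm_neg, norm_smul, norm_inv, Real.norm_of_nonneg η₁0.le, inv_mul_le_iff₀ η₁0]
    exact e1.trans (min_le_left _ _)
  · rw [norm_neg, norm_smul, norm_inv, Real.norm_of_nonneg η₁0.le, inv_mul_le_iff₀ η₁0]
    exact e2.trans ((min_le_right _ _).trans (min_le_left _ _))
  · exact e3.trans ((min_le_right _ _).trans (min_le_right _ _))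

end Newton

/-! ### The sequence `ϑₖ` and its sum -/

section Vartheta

variable {n : ℕ} {ε : ℝ}

theorem logb_natCast_nonneg (hn : 1 ≤ n) : 0 ≤ Real.logb 2 n :=
  Real.logb_nonneg one_lt_two (by exact_mod_cast hn)

theorem logb_one_div_pos (hε0 : 0 < ε) (hε1 : ε < 1) : 0 < Real.logb 2 (1 / ε) :=
  Real.logb_pos one_lt_two ((one_lt_div hε0).2 hε1)

theorem switchIndex_nonneg (hn : 1 ≤ n) (hε0 : 0 < ε) (hε1 : ε < 1) : 0 ≤ switchIndex n ε := by
  have h : (0 : ℝ) ≤ (⌊Real.logb 2 (1 / ε)⌋ : ℝ) := by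
    exact_mod_cast Int.floor_nonneg.2 (logb_one_div_pos hε0 hε1).le
  have := logb_natCast_nonneg hn
  unfold switchIndex
  positivity

theorem vartheta_of_switchIndex_le {k : ℕ} (hk : switchIndex n ε ≤ k) :
    vartheta n ε k = 1 / ((k : ℝ) + 1 - switchIndex n ε) ^ (1.1 : ℝ) := by
  rw [vartheta, if_neg (not_lt.2 hk)]

theorem vartheta_pos_of_switchIndex_le {k : ℕ} (hk : switchIndex n ε ≤ k) :
    0 < vartheta n ε k := by
  rw [vartheta_of_switchIndex_le hk]
  exact one_div_pos.2 (Real.rpow_pos_of_pos (by linarith) _)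

theorem vartheta_nonneg (hn : 1 ≤ n) (hε0 : 0 < ε) (hε1 : ε < 1) (k : ℕ) :
    0 ≤ vartheta n ε k := by
  by_cases hk : (k : ℝ) < switchIndex n ε
  · have := logb_natCast_nonneg hn
    have := logb_one_div_pos hε0 hε1
    rw [vartheta, if_pos hk]
    positivity
  · exact (vartheta_pos_of_switchIndex_le (not_lt.1 hk)).le

theorem vartheta_le_one (k : ℕ) : vartheta n ε k ≤ 1 := by
  by_cases hk : (k : ℝ) < switchIndex n ε
  · rw [vartheta, if_pos hk]
    exact min_le_left _ _
  · rw [vartheta_of_switchIndex_le (not_lt.1 hk)]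
    have h1 : (1 : ℝ) ≤ ((k : ℝ) + 1 - switchIndex n ε) ^ (1.1 : ℝ) :=
      Real.one_le_rpow (by linarith [not_lt.1 hk]) (by norm_num)
    exact (div_le_one (by linarith)).2 h1

theorem summable_one_div_succ_rpow : Summable fun j : ℕ => 1 / ((j : ℝ) + 1) ^ (1.1 : ℝ) := by
  have h := (summable_nat_add_iff 1).2 (Real.summable_one_div_nat_rpow.2
    (by norm_num : (1 : ℝ) < 1.1))
  simpa using h

theorem vartheta_add_ceil_le (j : ℕ) :
    vartheta n ε (j + ⌈switchIndex n ε⌉₊) ≤ 1 / ((j : ℝ) + 1) ^ (1.1 : ℝ) := by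
  have h := Nat.le_ceil (switchIndex n ε)
  have h2 : switchIndex n ε ≤ ((j + ⌈switchIndex n ε⌉₊ : ℕ) : ℝ) := by
    push_cast; linarith [j.cast_nonneg (α := ℝ)]
  rw [vartheta_of_switchIndex_le h2]
  refine one_div_le_one_div_of_le (by positivity) ?_
  refine Real.rpow_le_rpow (by positivity) ?_ (by norm_num)
  push_cast; linarith

theorem summable_vartheta (hn : 1 ≤ n) (hε0 : 0 < ε) (hε1 : ε < 1) :
    Summable (vartheta n ε) :=
  (summable_nat_add_iff ⌈switchIndex n ε⌉₊).1 <|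
    summable_one_div_succ_rpow.of_nonneg_of_le (fun _ => vartheta_nonneg hn hε0 hε1 _)
      vartheta_add_ceil_le

theorem tsum_vartheta_pos (hn : 1 ≤ n) (hε0 : 0 < ε) (hε1 : ε < 1) :
    0 < ∑' j, vartheta n ε j :=
  (summable_vartheta hn hε0 hε1).tsum_pos (vartheta_nonneg hn hε0 hε1) ⌈switchIndex n ε⌉₊
    (vartheta_pos_of_switchIndex_le (Nat.le_ceil _))

/-- There are `⌈N⌉` terms of size at most `1 / (log n · log (1/ε))`, and `N` is at most `n²` times
that denominator. When `N > 0` both logarithms are at least 1, so rounding `N` up costs at most 1.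
-/
theorem sum_range_vartheta_le (hn : 1 ≤ n) (hε0 : 0 < ε) (hε1 : ε < 1) :
    ∑ j ∈ Finset.range ⌈switchIndex n ε⌉₊, vartheta n ε j ≤ (n : ℝ) ^ 2 + 1 := by
  rcases (switchIndex_nonneg hn hε0 hε1).eq_or_lt with h0 | h0
  -- If `N = 0` (for `n = 1`, or `ε > 1/2`) the sum is empty, so a vanishing denominator `log n`
  -- plays no role.
  · rw [← h0]; simp; positivity
  have hl := logb_natCast_nonneg hn
  have hl' : Real.logb 2 n ≠ 0 := by
    intro h; rw [switchIndex, h] at h0; simp at h0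
  have hlpos := hl.lt_of_ne' hl'
  have hε := logb_one_div_pos hε0 hε1
  set l := Real.logb 2 n with hldef
  set e := Real.logb 2 (1 / ε) with hedef
  have hn2 : (1 : ℝ) ≤ l := by
    have h2 : 2 ≤ n := by
      by_contra hc
      have : n = 1 := by omega
      subst this
      simp [hldef] at hl'
    rw [hldef, Real.le_logb_iff_rpow_le one_lt_two (by positivity)]
    simpa using h2
  have hfl : (1 : ℝ) ≤ (⌊e⌋ : ℝ) := by
    have : 0 < (⌊e⌋ : ℝ) := by
      by_contra hc
      have : l * (n : ℝ) ^ 2 * (⌊e⌋ : ℝ) ≤ 0 :=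
        mul_nonpos_of_nonneg_of_nonpos (by positivity) (not_lt.1 hc)
      exact absurd h0 (not_lt.2 this)
    exact_mod_cast this
  have hfe : (⌊e⌋ : ℝ) ≤ e := Int.floor_le e
  have hbd : ∀ j ∈ Finset.range ⌈switchIndex n ε⌉₊, vartheta n ε j ≤ 1 / (l * e) := by
    intro j hj
    rw [vartheta, if_pos (Nat.lt_ceil.1 (Finset.mem_range.1 hj))]
    exact min_le_right _ _
  refine (Finset.sum_le_card_nsmul _ _ _ hbd).trans ?_
  have hle : (1 : ℝ) ≤ l * e := by nlinarith
  rw [Finset.card_range, nsmul_eq_mul, mul_one_div, div_le_iff₀ (by linarith)]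
  have hc := (Nat.ceil_lt_add_one h0.le).le
  have hN : switchIndex n ε ≤ (n : ℝ) ^ 2 * (l * e) := by
    have : switchIndex n ε = l * (n : ℝ) ^ 2 * (⌊e⌋ : ℝ) := rfl
    rw [this]
    have := mul_le_mul_of_nonneg_left hfe (show 0 ≤ l * (n : ℝ) ^ 2 by positivity)
    linarith
  linarith

/-- The bound is uniform in `ε`: the terms before the switch contribute at most `n² + 1`, the tail
at most a convergent series. -/
theorem tsum_vartheta_le (hn : 1 ≤ n) (hε0 : 0 < ε) (hε1 : ε < 1) :
    ∑' j, vartheta n ε j ≤ (2 + ∑' j : ℕ, 1 / ((j : ℝ) + 1) ^ (1.1 : ℝ)) * (n : ℝ) ^ 2 := by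
  have hs := summable_vartheta hn hε0 hε1
  rw [← hs.sum_add_tsum_nat_add ⌈switchIndex n ε⌉₊]
  have h1 := sum_range_vartheta_le hn hε0 hε1
  have h2 := ((summable_nat_add_iff ⌈switchIndex n ε⌉₊).2 hs).tsum_le_tsum vartheta_add_ceil_le
    summable_one_div_succ_rpow
  have h3 : 0 ≤ ∑' j : ℕ, 1 / ((j : ℝ) + 1) ^ (1.1 : ℝ) := tsum_nonneg fun _ => by positivity
  have h4 : (1 : ℝ) ≤ (n : ℝ) ^ 2 := one_le_pow₀ (by exact_mod_cast hn)
  nlinarith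

end Vartheta

/-! ### Bounds for the iterates and for conjugated shifts -/

section Bounds

theorem Problem.IsOptimal.trace_mul_eq_zero {P : Problem m n} {X S : Mat n} {y : Vec m}
    (h : P.IsOptimal X y S) : (X * S).trace = 0 := by
  obtain ⟨-, hX, -, hS, hgap⟩ := h
  have h1 := P.trace_adj_mul y X
  rw [hX] at h1
  rw [← hS, Matrix.add_mul, trace_add, h1] at hgap
  rw [trace_mul_comm]
  have : ∑ i, y i * P.b i = ∑ i, P.b i * y i := Finset.sum_congr rfl fun i _ => mul_comm _ _
  linarith

/-- Boundedness of the infeasible iterates, by orthogonality of the differences from the points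
of the segment between the starting point and the optimal solution. -/
theorem trace_add_trace_le (hn : 1 ≤ n) {P : Problem m n} {ρ γ τ : ℝ} (hρ : 0 < ρ)
    (hγ1 : γ ≤ 1) (hτ0 : 0 ≤ τ) (hτ1 : τ ≤ 1) {Xs Ss : Mat n} {ys : Vec m}
    (hopt : P.IsOptimal Xs ys Ss) (htr : 1 / (n : ℝ) * (Xs.trace + Ss.trace) ≤ ρ)
    {X S : Mat n} {y y₀ : Vec m} (hX : X.PosSemidef) (hS : S.PosSemidef)
    {ζd : Mat n} (hζd : ‖ζd‖ ≤ γ * ρ)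
    (hd : P.dualRes y S = τ • (P.dualRes y₀ (ρ • 1) + ζd))
    {ζp : Vec m} (hζp : ‖P.pinv ζp‖ ≤ γ * ρ)
    (hp : P.primalRes X = τ • (P.primalRes (ρ • 1) + ζp)) :
    (1 - γ) * (ρ * τ * (X.trace + S.trace)) ≤ (X * S).trace + 6 * n * (τ * ρ ^ 2) := by
  have hgap := hopt.trace_mul_eq_zero
  obtain ⟨hXs, hXb, hSs, hSc, -⟩ := hopt
  have hn' : (1 : ℝ) ≤ n := by exact_mod_cast hn
  have htr' : Xs.trace + Ss.trace ≤ n * ρ := by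
    rwa [one_div, inv_mul_le_iff₀ (by linarith)] at htr
  set Z := P.pinv ζp with hZ
  set Xh := τ • (ρ • (1 : Mat n) + Z) + (1 - τ) • Xs with hXh
  set Sh := τ • (ρ • (1 : Mat n) + ζd) + (1 - τ) • Ss with hSh
  have hK : P.op (X - Xh) = 0 := by
    have : P.op X = τ • (P.op (ρ • (1 : Mat n)) - P.b + ζp) + P.b := by
      rw [← sub_eq_iff_eq_add]; exact hp
    simp only [hXh, P.op_sub, this, P.op_add, P.op_smul, hZ, P.op_pinv, hXb]
    module
  have hL : S - Sh = P.adj (τ • y₀ + (1 - τ) • ys - y) := by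
    have : S = τ • (P.adj y₀ + ρ • (1 : Mat n) - P.C + ζd) - P.adj y + P.C := by
      have : P.adj y + S - P.C = τ • (P.adj y₀ + ρ • (1 : Mat n) - P.C + ζd) := hd
      rw [← this]; abel
    rw [P.adj_sub, P.adj_add, P.adj_smul, P.adj_smul, hSh, this, ← hSc]
    module
  -- Since `X - Xh` lies in the kernel of `𝒜` and `S - Sh` in the range of `𝒜ᵀ`, they are
  -- orthogonal. The left side then bounds the traces from below (`low`), and `tr (Xh Sh)` is
  -- bounded above (`up`).
  have horth : (X * Sh).trace + (Xh * S).trace = (X * S).trace + (Xh * Sh).trace := by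
    have := P.trace_mul_adj_eq_zero hK (τ • y₀ + (1 - τ) • ys - y)
    rw [← hL, Matrix.sub_mul, Matrix.mul_sub, Matrix.mul_sub, trace_sub, trace_sub,
      trace_sub] at this
    linarith
  have hτ1' : 0 ≤ 1 - τ := sub_nonneg.2 hτ1
  have hγρ : γ * ρ ≤ ρ := mul_le_of_le_one_left hρ.le hγ1
  have low : ∀ {U V Vs : Mat n}, U.PosSemidef → Vs.PosSemidef → ‖V‖ ≤ γ * ρ →
      τ * ((1 - γ) * ρ * U.trace) ≤
        ((τ • (ρ • (1 : Mat n) + V) + (1 - τ) • Vs) * U).trace := by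
    intro U V Vs hU hVs hV
    simp only [Matrix.add_mul, Matrix.smul_mul, trace_add, trace_smul, smul_eq_mul, Matrix.one_mul]
    have h1 := neg_le_trace_mul V U
    have h2 := mul_le_mul hV (norm_le_trace_of_posSemidef hU) (norm_nonneg _)
      ((norm_nonneg _).trans hV)
    have h3 : (1 - γ) * ρ * U.trace ≤ ρ * U.trace + (V * U).trace := by linarith
    have h4 := mul_le_mul_of_nonneg_left h3 hτ0
    have h5 := mul_nonneg hτ1' (trace_mul_nonneg hVs hU)
    linarith
  have l1 := low hS hXs hζp
  have l2 := low hX hSs hζd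
  rw [trace_mul_comm _ X] at l2
  -- The complementary product `Xs Ss` has trace zero, so every remaining term carries a factor `τ`.
  -- Here `6 = 4 + 2`, from `c1` and `c2`.
  have up : (Xh * Sh).trace ≤ 6 * n * (τ * ρ ^ 2) := by
    have e : (Xh * Sh).trace = τ ^ 2 * (ρ ^ 2 * n + ρ * ζd.trace + ρ * Z.trace + (Z * ζd).trace)
        + τ * (1 - τ) * (ρ * Ss.trace + (Z * Ss).trace + ρ * Xs.trace + (Xs * ζd).trace) := by
      simp only [hXh, hSh, Matrix.add_mul, Matrix.mul_add, Matrix.smul_mul, Matrix.mul_smul,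
        trace_add, trace_smul, smul_eq_mul, Matrix.one_mul, Matrix.mul_one, trace_one,
        Fintype.card_fin, hgap]
      ring
    have hZ1 : ‖Z‖ ≤ ρ := hζp.trans hγρ
    have hζ1 : ‖ζd‖ ≤ ρ := hζd.trans hγρ
    have b1 := (trace_le_norm hn ζd).trans (mul_le_mul_of_nonneg_left hζ1 (by positivity))
    have b2 := (trace_le_norm hn Z).trans (mul_le_mul_of_nonneg_left hZ1 (by positivity))
    have b3 := (trace_mul_le Z ζd).trans (mul_le_mul hZ1 hζ1 (norm_nonneg _) hρ.le)
    have b4 := (trace_mul_le Z Ss).trans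
      (mul_le_mul hZ1 (norm_le_trace_of_posSemidef hSs) (norm_nonneg _) hρ.le)
    have b5 := (trace_mul_le Xs ζd).trans
      (mul_le_mul (norm_le_trace_of_posSemidef hXs) hζ1 (norm_nonneg _) hXs.trace_nonneg)
    have c1 : ρ ^ 2 * n + ρ * ζd.trace + ρ * Z.trace + (Z * ζd).trace ≤ 4 * n * ρ ^ 2 := by
      linarith [mul_le_mul_of_nonneg_left b1 hρ.le, mul_le_mul_of_nonneg_left b2 hρ.le,
        mul_le_mul_of_nonneg_right hn' (sq_nonneg ρ)]
    have c2 : ρ * Ss.trace + (Z * Ss).trace + ρ * Xs.trace + (Xs * ζd).trace ≤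
        2 * n * ρ ^ 2 := by
      linarith [mul_le_mul_of_nonneg_left htr' hρ.le]
    have d1 : τ ^ 2 ≤ τ := pow_le_of_le_one hτ0 hτ1 two_ne_zero
    have d2 : τ * (1 - τ) ≤ τ := mul_le_of_le_one_right hτ0 (by linarith)
    have n1 : 0 ≤ 4 * n * ρ ^ 2 := by positivity
    have n2 : 0 ≤ 2 * n * ρ ^ 2 := by positivity
    rw [e]
    have f1 := (mul_le_mul_of_nonneg_left c1 (sq_nonneg τ)).trans (mul_le_mul_of_nonneg_right d1 n1)
    have f2 := (mul_le_mul_of_nonneg_left c2 (mul_nonneg hτ0 hτ1')).trans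
      (mul_le_mul_of_nonneg_right d2 n2)
    linarith
  linarith

/-- For the positive semidefinite part the norm is bounded by the trace, where `Q` can be dropped.
This gives `ρ ‖T‖²` without the factor `√n` that `‖ρ I‖` would bring. -/
theorem norm_conj_le {T Q Z Y : Mat n} {ρ c : ℝ} (hT : T.IsSymm) (hc : 0 ≤ c)
    (hQ : Q.PosSemidef) (hρQ : (ρ • (1 : Mat n) - Q).PosSemidef) :
    ‖T * (c • (ρ • (1 : Mat n) - Q + Z) + Y) * T‖ ≤ (c * (ρ + ‖Z‖) + ‖Y‖) * ‖T‖ ^ 2 := by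
  have key : ∀ V : Mat n, ‖T * V * T‖ ≤ ‖V‖ * ‖T‖ ^ 2 := fun V => by
    have h1 := frobenius_norm_mul (T * V) T
    have h2 := mul_le_mul_of_nonneg_right (frobenius_norm_mul T V) (norm_nonneg T)
    linarith
  have conj : ∀ {V : Mat n}, V.PosSemidef → (T * V * T).PosSemidef := fun {V} hV => by
    have := hV.mul_mul_conjTranspose_same T
    rwa [conjTranspose_eq_transpose_of_trivial, hT.eq] at this
  have h1 : ‖T * (ρ • (1 : Mat n) - Q) * T‖ ≤ ρ * ‖T‖ ^ 2 := by
    refine (norm_le_trace_of_posSemidef (conj hρQ)).trans ?_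
    have := (conj hQ).trace_nonneg
    rw [norm_sq_eq_trace, hT.eq]
    simp only [Matrix.mul_sub, Matrix.sub_mul, Matrix.mul_smul, Matrix.smul_mul, Matrix.mul_one,
      trace_sub, trace_smul, smul_eq_mul]
    linarith
  have e : T * (c • (ρ • (1 : Mat n) - Q + Z) + Y) * T =
      c • (T * (ρ • (1 : Mat n) - Q) * T) + c • (T * Z * T) + T * Y * T := by
    rw [Matrix.mul_add, Matrix.add_mul, Matrix.mul_smul, Matrix.smul_mul, Matrix.mul_add,
      Matrix.add_mul, smul_add]
  rw [e]
  refine norm_add₃_le.trans ?_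
  rw [norm_smul, norm_smul, Real.norm_of_nonneg hc]
  have k1 := mul_le_mul_of_nonneg_left h1 hc
  have k2 := mul_le_mul_of_nonneg_left (key Z) hc
  linarith [key Y]

/-- With `T = S^{1/2}`, `tr X` is the trace of `T X T` against `T⁻²`, and `T X T` is close to `μ I`.
-/
theorem norm_inv_sqrt_sq_le {S X : Mat n} {μ γ : ℝ} (hS : S.PosDef)
    (hM : ‖CFC.sqrt S * X * CFC.sqrt S - μ • (1 : Mat n)‖ ≤ γ * μ) :
    (1 - γ) * μ * ‖(CFC.sqrt S)⁻¹‖ ^ 2 ≤ X.trace := by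
  set T := CFC.sqrt S
  have hT := isUnit_det_sqrt hS
  have hW : (T⁻¹)ᵀ = T⁻¹ := by rw [transpose_nonsing_inv, sqrt_transpose]
  have h1 : (T * X * T * (T⁻¹ * T⁻¹)).trace = X.trace := by
    rw [← Matrix.mul_assoc, mul_nonsing_inv_cancel_right _ _ hT, trace_mul_comm,
      nonsing_inv_mul_cancel_left _ _ hT]
  have h2 := neg_le_trace_mul (T * X * T - μ • (1 : Mat n)) (T⁻¹ * T⁻¹)
  rw [Matrix.sub_mul, trace_sub, h1, Matrix.smul_mul, Matrix.one_mul, trace_smul, smul_eq_mul] at h2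
  have h3 : ‖T⁻¹‖ ^ 2 = (T⁻¹ * T⁻¹).trace := by rw [norm_sq_eq_trace, hW]
  have h4 := mul_le_mul hM (frobenius_norm_mul T⁻¹ T⁻¹) (norm_nonneg _)
    ((norm_nonneg _).trans hM)
  rw [← h3] at h2
  linarith

/-- The complementarity row in scaled variables, to which the estimates on `M`, `dX`, `dS` apply. -/
theorem hkm_newton {S X dX dS : Mat n} (hS : S.PosDef) :
    hkm S (X * dS + dX * S) = symmPart ((CFC.sqrt S * X * CFC.sqrt S) *
      ((CFC.sqrt S)⁻¹ * dS * (CFC.sqrt S)⁻¹) + CFC.sqrt S * dX * CFC.sqrt S) := by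
  have hT := isUnit_det_sqrt hS
  rw [hkm_eq_symmPart]
  congr 1
  have h1 : dX * S * (CFC.sqrt S)⁻¹ = dX * CFC.sqrt S := by
    conv_lhs => enter [1, 2]; rw [← sqrt_mul_sqrt hS.posSemidef]
    rw [← Matrix.mul_assoc, mul_nonsing_inv_cancel_right _ _ hT]
  rw [Matrix.mul_add, Matrix.add_mul]
  congr 1
  · simp only [Matrix.mul_assoc]
    rw [mul_nonsing_inv_cancel_left _ _ hT]
  · rw [Matrix.mul_assoc, h1, Matrix.mul_assoc]

end Bounds

/-! ### Size of the scaled search directions -/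

section Direction

/-- The constant in the bound `‖S^{-1/2} ΔS S^{-1/2}‖ ≤ c n`. -/
noncomputable def dualConst (p : Params) : ℝ :=
  -- The numerator collects the bounds for the right-hand side, the primal shift and `1 + γ₂ ≤ 2`
  -- times the dual shift; the last summand removes the dual shift again. Here `24 = 3 · 8`, from
  -- `shift_coeff_le` and `neighborhood.trace_le`.
  (3 + 24 / (1 - p.γ₁) + 48 / ((1 - p.γ₁) * (1 - p.γ₂))) / (1 - p.γ₂) +
    24 / ((1 - p.γ₁) * (1 - p.γ₂))

/-- The constant in the bound `‖S^{1/2} ΔX S^{1/2}‖ ≤ c n θ μ₀`. -/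
noncomputable def primalConst (p : Params) : ℝ := 3 + 2 * dualConst p

theorem dualConst_pos (p : Params) : 0 < dualConst p := by
  have h1 : 0 < 1 - p.γ₁ := sub_pos.2 p.γ₁_mem.2
  have h2 : 0 < 1 - p.γ₂ := sub_pos.2 p.γ₂_mem.2
  unfold dualConst
  positivity

theorem primalConst_pos (p : Params) : 0 < primalConst p := by
  have := dualConst_pos p
  unfold primalConst
  positivity

/-- Substituting `C = 𝒜ᵀ ys + Ss` splits the initial dual residual into `𝒜ᵀ (y₀ - ys)` and `ρ I -
Ss`. The shift cancels everything outside the range of `𝒜ᵀ`. -/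
theorem dual_shift_eq_adj {P : Problem m n} {Xs Ss S ΔS ζd rd : Mat n} {ys y y₀ Δy : Vec m}
    {ρ τ η : ℝ} (hopt : P.IsOptimal Xs ys Ss)
    (hd : P.dualRes y S = τ • (P.dualRes y₀ (ρ • 1) + ζd))
    (hN : P.adj Δy + ΔS = -(η • (P.dualRes y S + rd))) :
    ΔS + ((η * τ) • (ρ • (1 : Mat n) - Ss + ζd) + η • rd) =
      P.adj (-Δy - (η * τ) • (y₀ - ys)) := by
  have h : ΔS = -(η • (P.dualRes y S + rd)) - P.adj Δy := by rw [← hN]; abel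
  have hneg : P.adj (-Δy) = -P.adj Δy := by
    have := P.adj_smul (-1) Δy
    simpa using this
  rw [h, hd, Problem.dualRes, ← hopt.2.2.2.1]
  simp only [P.adj_sub, P.adj_smul, hneg]
  module

theorem op_primal_shift_eq_zero {P : Problem m n} {Xs X Ss ΔX : Mat n} {ys ζp rp : Vec m}
    {ρ τ η : ℝ} (hopt : P.IsOptimal Xs ys Ss)
    (hp : P.primalRes X = τ • (P.primalRes (ρ • 1) + ζp))
    (hN : P.op ΔX = -(η • (P.primalRes X + rp))) :
    P.op (ΔX + ((η * τ) • (ρ • (1 : Mat n) - Xs + P.pinv ζp) + η • P.pinv rp)) = 0 := by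
  rw [P.op_add, hN, hp, Problem.primalRes]
  simp only [P.op_add, P.op_sub, P.op_smul, P.op_pinv, hopt.2.1]
  module

theorem shift_coeff_le {η τ ρ γ a b : ℝ} (hη0 : 0 ≤ η) (hη1 : η ≤ 1) (hτ : 0 ≤ τ) (hρ : 0 ≤ ρ)
    (hγ : γ ≤ 1) (ha : a ≤ γ * ρ) (hb : b ≤ γ * ρ * τ) :
    η * τ * (ρ + a) + η * b ≤ 3 * (ρ * τ) := by
  have h1 : a ≤ ρ := ha.trans (mul_le_of_le_one_left hρ hγ)
  have h2 : b ≤ ρ * τ := hb.trans (mul_le_mul_of_nonneg_right (mul_le_of_le_one_left hρ hγ) hτ)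
  have h3 : η * τ * (ρ + a) + η * b ≤ η * (3 * (ρ * τ)) := by
    have := mul_le_mul_of_nonneg_left h1 hτ
    have h4 : τ * (ρ + a) + b ≤ 3 * (ρ * τ) := by linarith
    have := mul_le_mul_of_nonneg_left h4 hη0
    linarith
  exact h3.trans (mul_le_of_le_one_left (by positivity) hη1)

/-- Centrality gives `tr (X S) ≤ 2 n θ ρ²`, and `τ ≤ θ` turns the remaining `6 n τ ρ²` into `6 n θ
ρ²`. -/
theorem neighborhood.trace_le {P : Problem m n} {p : Params} {ρ : ℝ} {y₀ : Vec m} (hn : 1 ≤ n)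
    (hρ : 0 < ρ) {Xs Ss : Mat n} {ys : Vec m} (hopt : P.IsOptimal Xs ys Ss)
    (htr : 1 / (n : ℝ) * (Xs.trace + Ss.trace) ≤ ρ) {z : Iterate m n}
    (hz : z ∈ neighborhood P p ρ y₀) (hτ1 : z.τ ≤ 1) :
    (1 - p.γ₁) * (ρ * z.τ * (z.X.trace + z.S.trace)) ≤ 8 * n * (z.θ * ρ ^ 2) := by
  obtain ⟨hτ0, hτθ, hX, hS, ⟨ζd, hζd, hd⟩, ⟨ζp, hζp, hp⟩, hc⟩ := hz
  have h := trace_add_trace_le hn hρ p.γ₁_mem.2.le hτ0 hτ1 hopt htr hX hS.posSemidef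
    hζd hd hζp hp
  have hXs : z.X.IsSymm := isSymm_of_posSemidef hX
  rw [hkm_mul_self hS hXs] at hc
  have hμ : 0 ≤ z.θ * ρ ^ 2 := mul_nonneg (hτ0.trans hτθ) (sq_nonneg _)
  have h1 : (z.X * z.S).trace = (CFC.sqrt z.S * z.X * CFC.sqrt z.S).trace := by
    conv_rhs => rw [trace_mul_comm, ← Matrix.mul_assoc, sqrt_mul_sqrt hS.posSemidef, trace_mul_comm]
  have h2 := trace_le_norm hn
    (CFC.sqrt z.S * z.X * CFC.sqrt z.S - (z.θ * ρ ^ 2) • (1 : Mat n))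
  rw [trace_sub, ← h1, trace_smul, trace_one, Fintype.card_fin, smul_eq_mul] at h2
  have h3 : p.γ₂ * (z.θ * ρ ^ 2) ≤ z.θ * ρ ^ 2 := mul_le_of_le_one_left hμ p.γ₂_mem.2.le
  have h4 := mul_le_mul_of_nonneg_left (hc.trans h3) (Nat.cast_nonneg (α := ℝ) n)
  have h5 := mul_le_mul_of_nonneg_left (mul_le_mul_of_nonneg_right hτθ (sq_nonneg ρ))
    (show (0 : ℝ) ≤ 6 * n by positivity)
  linarith

/-- Scaled search directions are of order `n`. -/
theorem IsInexactDirection.norm_le {P : Problem m n} {p : Params} {ρ : ℝ} {y₀ : Vec m}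
    (hn : 1 ≤ n) (hρ : 0 < ρ) {Xs Ss : Mat n} {ys : Vec m} (hopt : P.IsOptimal Xs ys Ss)
    (hXle : (ρ • (1 : Mat n) - Xs).PosSemidef) (hSle : (ρ • (1 : Mat n) - Ss).PosSemidef)
    (htr : 1 / (n : ℝ) * (Xs.trace + Ss.trace) ≤ ρ) {ϑhat ϑ : ℝ} (hϑhat : 0 < ϑhat)
    (hadj : ∀ v : Vec m, ϑhat * ‖v‖ ≤ ‖P.adj v‖) (hϑ1 : ϑ ≤ 1)
    {z : Iterate m n} (hz : z ∈ neighborhood P p ρ y₀) (hτ1 : z.τ ≤ 1) (hθ : 0 < z.θ)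
    {d : Triple m n} (hdir : IsInexactDirection P p ρ ϑhat ϑ z d) :
    ‖(CFC.sqrt z.S)⁻¹ * d.2.2 * (CFC.sqrt z.S)⁻¹‖ ≤ dualConst p * n ∧
      ‖CFC.sqrt z.S * d.1 * CFC.sqrt z.S‖ ≤ primalConst p * n * (z.θ * ρ ^ 2) := by
  have htrace := neighborhood.trace_le hn hρ hopt htr hz hτ1
  obtain ⟨hτ0, hτθ, hX, hS, ⟨ζd, hζd, hd⟩, ⟨ζp, hζp, hp⟩, hc⟩ := hz
  obtain ⟨⟨hdX, hdS⟩, ⟨rd, rp, rc⟩, hN, hrd, hrp, hrc⟩ := hdir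
  obtain ⟨ΔX, Δy, ΔS⟩ := d
  simp only [Problem.newton, Problem.newtonRhs, Prod.mk.injEq] at hN hdX hdS hrd hrp hrc ⊢
  obtain ⟨hN1, hN2, hN3⟩ := hN
  have hXs : z.X.IsSymm := isSymm_of_posSemidef hX
  rw [hkm_mul_self hS hXs] at hc hN3
  rw [hkm_newton hS] at hN3
  have hγ₁ := p.γ₁_mem
  have hγ₂ := p.γ₂_mem
  have hη₁ := p.η₁_mem
  have hη₂ := p.η₂_mem
  have hL := dual_shift_eq_adj hopt hd hN1
  have hK := op_primal_shift_eq_zero hopt hp hN2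
  have hrp' : ‖P.pinv rp‖ ≤ p.γ₁ * ρ * z.τ := by
    have h1 := (P.norm_pinv_le hϑhat hadj rp).trans hrp
    have h2 := le_of_mul_le_mul_left h1 hϑhat
    exact h2.trans (mul_le_of_le_one_right (by have := hγ₁.1; positivity) hϑ1)
  have hrd' : ‖rd‖ ≤ p.γ₁ * ρ * z.τ :=
    hrd.trans (mul_le_of_le_one_right (by have := hγ₁.1; positivity) hϑ1)
  set T := CFC.sqrt z.S with hTdef
  have hT : IsUnit T.det := isUnit_det_sqrt hS
  have hTs : T.IsSymm := sqrt_transpose z.S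
  have hWs : (T⁻¹).IsSymm := by rw [IsSymm, transpose_nonsing_inv, hTs.eq]
  set A := (p.η₁ * z.τ) • (ρ • (1 : Mat n) - Xs + P.pinv ζp) + p.η₁ • P.pinv rp with hA
  set B := (p.η₁ * z.τ) • (ρ • (1 : Mat n) - Ss + ζd) + p.η₁ • rd with hB
  have hητ : 0 ≤ p.η₁ * z.τ := mul_nonneg hη₁.1.le hτ0
  have ha : ‖T * A * T‖ ≤ 3 * (ρ * z.τ) * ‖T‖ ^ 2 := by
    refine (norm_conj_le hTs hητ hopt.1 hXle).trans (mul_le_mul_of_nonneg_right ?_ (sq_nonneg _))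
    rw [norm_smul, Real.norm_of_nonneg hη₁.1.le]
    exact shift_coeff_le hη₁.1.le hη₁.2 hτ0 hρ.le hγ₁.2.le hζp hrp'
  have hb : ‖T⁻¹ * B * T⁻¹‖ ≤ 3 * (ρ * z.τ) * ‖T⁻¹‖ ^ 2 := by
    refine (norm_conj_le hWs hητ hopt.2.2.1 hSle).trans
      (mul_le_mul_of_nonneg_right ?_ (sq_nonneg _))
    rw [norm_smul, Real.norm_of_nonneg hη₁.1.le]
    exact shift_coeff_le hη₁.1.le hη₁.2 hτ0 hρ.le hγ₁.2.le hζd hrd'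
  have hTsq : ‖T‖ ^ 2 = z.S.trace := by
    rw [norm_sq_eq_trace, hTs.eq, sqrt_mul_sqrt hS.posSemidef]
  have hWsq := norm_inv_sqrt_sq_le hS hc
  set μ := z.θ * ρ ^ 2 with hμdef
  have hμ : 0 < μ := by positivity
  have hn' : (1 : ℝ) ≤ n := by exact_mod_cast hn
  have hδ : 0 < 1 - p.γ₁ := sub_pos.2 hγ₁.2
  have hκ : 0 < 1 - p.γ₂ := sub_pos.2 hγ₂.2
  have hρτ : 0 ≤ ρ * z.τ := mul_nonneg hρ.le hτ0
  have hSt : ρ * z.τ * z.S.trace ≤ 8 * n * μ / (1 - p.γ₁) := by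
    rw [le_div_iff₀ hδ]
    have := mul_nonneg hδ.le (mul_nonneg hρτ hX.trace_nonneg)
    linarith
  have hXt : ρ * z.τ * z.X.trace ≤ 8 * n * μ / (1 - p.γ₁) := by
    rw [le_div_iff₀ hδ]
    have := mul_nonneg hδ.le (mul_nonneg hρτ hS.posSemidef.trace_nonneg)
    linarith
  have ha' : ‖T * A * T‖ ≤ 24 / (1 - p.γ₁) * (n * μ) := by
    rw [hTsq] at ha
    have : 24 / (1 - p.γ₁) * (n * μ) = 3 * (8 * n * μ / (1 - p.γ₁)) := by ring
    rw [this]; linarith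
  have hb' : ‖T⁻¹ * B * T⁻¹‖ ≤ 24 / ((1 - p.γ₁) * (1 - p.γ₂)) * n := by
    have h1 := mul_le_mul_of_nonneg_left hWsq hρτ
    have h2 : (1 - p.γ₂) * μ * ‖T⁻¹ * B * T⁻¹‖ ≤ 3 * (8 * n * μ / (1 - p.γ₁)) := by
      have := mul_le_mul_of_nonneg_left hb (mul_pos hκ hμ).le
      linarith
    refine le_of_mul_le_mul_left (h2.trans_eq ?_) (mul_pos hκ hμ)
    field_simp
    ring
  -- The scalings by `T` and `T⁻¹` cancel under the trace, so orthogonality of kernel and range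
  -- survives.
  have horth : ((T * ΔX * T + T * A * T) * (T⁻¹ * ΔS * T⁻¹ + T⁻¹ * B * T⁻¹)).trace = 0 := by
    have e : (T * ΔX * T + T * A * T) * (T⁻¹ * ΔS * T⁻¹ + T⁻¹ * B * T⁻¹) =
        T * ((ΔX + A) * (ΔS + B)) * T⁻¹ := by
      rw [← Matrix.add_mul, ← Matrix.add_mul, ← Matrix.mul_add, ← Matrix.mul_add]
      simp only [Matrix.mul_assoc]
      rw [mul_nonsing_inv_cancel_left _ _ hT]
    rw [e, trace_mul_comm, nonsing_inv_mul_cancel_left _ _ hT, hL]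
    exact P.trace_mul_adj_eq_zero hK _
  have hE : (T⁻¹ * ΔS * T⁻¹ + T⁻¹ * B * T⁻¹).IsSymm := by
    rw [← Matrix.add_mul, ← Matrix.mul_add, hL]
    simp only [IsSymm, transpose_mul, hWs.eq, (P.adj_isSymm _).eq, Matrix.mul_assoc]
  -- One `n μ` each for the centrality defect, the target reduction `η₂ μ I` and `r^c`.
  have hR : ‖((1 - p.η₂) * z.θ * ρ ^ 2) • (1 : Mat n) - T * z.X * T + rc‖ ≤ 3 * (n * μ) := by
    have e : ((1 - p.η₂) * z.θ * ρ ^ 2) • (1 : Mat n) - T * z.X * T + rc =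
        -(T * z.X * T - μ • (1 : Mat n)) + (-(p.η₂ * μ)) • (1 : Mat n) + rc := by
      rw [hμdef]; module
    rw [e]
    refine norm_add₃_le.trans ?_
    rw [norm_neg, norm_smul, norm_neg, Real.norm_of_nonneg (mul_nonneg hη₂.1.le hμ.le)]
    have h1 : ‖T * z.X * T - μ • (1 : Mat n)‖ ≤ n * μ :=
      hc.trans (mul_le_mul_of_nonneg_right (hγ₂.2.le.trans hn') hμ.le)
    have h2 : p.η₂ * μ * ‖(1 : Mat n)‖ ≤ n * μ := by
      have := mul_le_mul (mul_le_of_le_one_left hμ.le hη₂.2.le) (norm_one_le hn)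
        (norm_nonneg _) hμ.le
      linarith
    have h3 : ‖rc‖ ≤ n * μ := by
      refine hrc.trans ?_
      have h4 : 1 / 2 * (1 - p.η₂) * p.γ₂ ≤ n := by nlinarith [hη₂.1, hη₂.2, hγ₂.1, hγ₂.2]
      have := mul_le_mul_of_nonneg_right h4 hμ.le
      have e : complTol p ρ z = 1 / 2 * (1 - p.η₂) * p.γ₂ * μ := by
        rw [complTol, hμdef]; ring
      rwa [e]
    linarith
  have hdXs : (T * ΔX * T).IsSymm := by
    simp only [IsSymm, transpose_mul, hTs.eq, hdX.eq, Matrix.mul_assoc]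
  have hEb := norm_add_shift_le hμ hγ₂.1.le hc horth hE hN3
  have hEb' : ‖T⁻¹ * ΔS * T⁻¹ + T⁻¹ * B * T⁻¹‖ ≤
      (3 + 24 / (1 - p.γ₁) + 48 / ((1 - p.γ₁) * (1 - p.γ₂))) / (1 - p.γ₂) * n := by
    have h1 : (1 + p.γ₂) * μ * ‖T⁻¹ * B * T⁻¹‖ ≤ 48 / ((1 - p.γ₁) * (1 - p.γ₂)) * (n * μ) := by
      have h2 : (1 + p.γ₂) * μ ≤ 2 * μ := mul_le_mul_of_nonneg_right (by linarith [hγ₂.2]) hμ.le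
      refine (mul_le_mul h2 hb' (norm_nonneg _) (by positivity)).trans_eq ?_
      ring
    refine le_of_mul_le_mul_left ?_ (mul_pos hκ hμ)
    have e : (1 - p.γ₂) * μ * ((3 + 24 / (1 - p.γ₁) + 48 / ((1 - p.γ₁) * (1 - p.γ₂))) /
        (1 - p.γ₂) * n) = 3 * (n * μ) + 24 / (1 - p.γ₁) * (n * μ) +
          48 / ((1 - p.γ₁) * (1 - p.γ₂)) * (n * μ) := by
      field_simp
    rw [e]
    linarith
  have hdual : ‖T⁻¹ * ΔS * T⁻¹‖ ≤ dualConst p * n := by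
    have h1 := norm_sub_le (T⁻¹ * ΔS * T⁻¹ + T⁻¹ * B * T⁻¹) (T⁻¹ * B * T⁻¹)
    rw [add_sub_cancel_right] at h1
    rw [dualConst, add_mul]
    linarith
  refine ⟨hdual, ?_⟩
  have h1 := norm_primal_le hμ hc hdXs hN3
  have h2 : (1 + p.γ₂) * μ ≤ 2 * μ := mul_le_mul_of_nonneg_right (by linarith [hγ₂.2]) hμ.le
  have h3 := mul_le_mul h2 hdual (norm_nonneg _) (by positivity)
  rw [primalConst]
  linarith

end Direction

/-! ### Effect of one step: residuals and neighbourhood -/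

section Step

/-- The residuals of `z` are `τ` times those of the starting point, up to perturbations of relative
size `s / V`. -/
structure Tracked (P : Problem m n) (p : Params) (ρ : ℝ) (y₀ : Vec m) (V s : ℝ)
    (z : Iterate m n) : Prop where
  τ_pos : 0 < z.τ
  τ_le_one : z.τ ≤ 1
  θ_pos : 0 < z.θ
  dual : ∃ ζd : Mat n, ‖ζd‖ * V ≤ p.γ₁ * ρ * s ∧
    P.dualRes z.y z.S = z.τ • (P.dualRes y₀ (ρ • 1) + ζd)
  primal : ∃ ζp : Vec m, ‖P.pinv ζp‖ * V ≤ p.γ₁ * ρ * s ∧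
    P.primalRes z.X = z.τ • (P.primalRes (ρ • 1) + ζp)

theorem tracked_start (P : Problem m n) (p : Params) (ρ : ℝ) (y₀ : Vec m) (V : ℝ) :
    Tracked P p ρ y₀ V 0 (start n ρ y₀) where
  τ_pos := one_pos
  τ_le_one := le_rfl
  θ_pos := one_pos
  dual := ⟨0, by simp, by simp [start]⟩
  primal := ⟨0, by
    have h : P.pinv 0 = 0 := by simpa using P.pinv_smul 0 0
    simp [h], by simp [start]⟩

theorem start_mem_neighborhood (P : Problem m n) (p : Params) {ρ : ℝ} (hρ : 0 < ρ) (y₀ : Vec m) :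
    start n ρ y₀ ∈ neighborhood P p ρ y₀ := by
  obtain ⟨γ₁0, -⟩ := p.γ₁_mem
  obtain ⟨γ₂0, -⟩ := p.γ₂_mem
  have hS : (ρ • (1 : Mat n)).PosDef := PosDef.one.smul hρ
  have h : P.pinv 0 = 0 := by simpa using P.pinv_smul 0 0
  refine ⟨zero_le_one, le_rfl, hS.posSemidef, hS, ⟨0, ?_, by simp [start]⟩,
    ⟨0, ?_, by simp [start]⟩, ?_⟩
  · rw [norm_zero]; positivity
  · rw [h, norm_zero]; positivity
  · change ‖hkm (ρ • (1 : Mat n)) ((ρ • (1 : Mat n)) * (ρ • (1 : Mat n))) -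
      ((1 : ℝ) * ρ ^ 2) • (1 : Mat n)‖ ≤ p.γ₂ * (1 * ρ ^ 2)
    rw [hkm_mul_self hS (isSymm_of_posSemidef hS.posSemidef), Matrix.mul_smul, Matrix.mul_one,
      Matrix.smul_mul, sqrt_mul_sqrt hS.posSemidef, smul_smul, one_mul, sq, sub_self, norm_zero]
    positivity

theorem one_sub_pos_of_mul_le {q V : ℝ} (hV : 0 < V) (hqV : q * (1 + V) ≤ 1) : 0 < 1 - q := by
  by_contra h
  nlinarith [mul_pos (show 0 < q by linarith) hV]

/-- The cap `q (1 + V) ≤ 1` says exactly that `q V / (1 - q) ≤ 1`, so a residual of relative size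
`ϑ` enlarges the perturbation by at most `c ϑ / V`. -/
theorem perturbation_le {q V τ c ϑ r ζ s : ℝ} (hq0 : 0 ≤ q) (hV : 0 < V) (hqV : q * (1 + V) ≤ 1)
    (hτ : 0 < τ) (hr : r ≤ c * τ * ϑ) (hcϑ : 0 ≤ c * ϑ) (hζ : ζ * V ≤ c * s) :
    (ζ + q / ((1 - q) * τ) * r) * V ≤ c * (s + ϑ) := by
  have hq1 : 0 < 1 - q := one_sub_pos_of_mul_le hV hqV
  have h1 : q / ((1 - q) * τ) * r * V ≤ c * ϑ := by
    have h2 : q / ((1 - q) * τ) * r * V ≤ q / ((1 - q) * τ) * (c * τ * ϑ) * V := by gcongr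
    have h3 : q / ((1 - q) * τ) * (c * τ * ϑ) * V = q * V / (1 - q) * (c * ϑ) := by
      field_simp
    rw [h3] at h2
    refine h2.trans (mul_le_of_le_one_left hcϑ ?_)
    rw [div_le_one hq1]
    linarith
  linarith

theorem Tracked.move {P : Problem m n} {p : Params} {ρ : ℝ} {y₀ : Vec m} {V s : ℝ}
    {z : Iterate m n} (hz : Tracked P p ρ y₀ V s z) (hρ : 0 < ρ) (hV : 0 < V) {ϑhat ϑ : ℝ}
    (hϑhat : 0 < ϑhat) (hadj : ∀ v : Vec m, ϑhat * ‖v‖ ≤ ‖P.adj v‖) (hϑ0 : 0 ≤ ϑ)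
    {d : Triple m n} (hdir : IsInexactDirection P p ρ ϑhat ϑ z d) {α : ℝ} (hα : 0 ≤ α)
    (hαV : α * p.η₁ * (1 + V) ≤ 1) :
    Tracked P p ρ y₀ V (s + ϑ) (move p z d α) := by
  obtain ⟨hτ, hτ1, hθ, ⟨ζd, hζd, hd⟩, ⟨ζp, hζp, hp⟩⟩ := hz
  obtain ⟨-, ⟨rd, rp, rc⟩, hN, hrd, hrp, -⟩ := hdir
  obtain ⟨ΔX, Δy, ΔS⟩ := d
  simp only [Problem.newton, Problem.newtonRhs, Prod.mk.injEq] at hN hrd hrp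
  obtain ⟨hN1, hN2, -⟩ := hN
  have hη₁ := p.η₁_mem.1
  have hq0 : 0 ≤ α * p.η₁ := mul_nonneg hα hη₁.le
  have hq1 : 0 < 1 - α * p.η₁ := one_sub_pos_of_mul_le hV hαV
  have hq2 : 0 < 1 - α * p.η₂ := by
    have := mul_le_mul_of_nonneg_left p.η₂_le hα
    linarith
  have hτ' : 0 < (1 - α * p.η₁) * z.τ := mul_pos hq1 hτ
  have hcϑ : 0 ≤ p.γ₁ * ρ * ϑ := by have := p.γ₁_mem.1; positivity
  have hcoef : 0 ≤ α * p.η₁ / ((1 - α * p.η₁) * z.τ) := by positivity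
  have hcancel : (1 - α * p.η₁) * z.τ * (α * p.η₁ / ((1 - α * p.η₁) * z.τ)) = α * p.η₁ :=
    mul_div_cancel₀ _ hτ'.ne'
  refine ⟨hτ', ?_, mul_pos hq2 hθ, ?_, ?_⟩
  · exact mul_le_one₀ (by linarith) hτ.le hτ1
  -- With `q = α η₁` the new residual is `(1 - q) τ (R₀ + ζ) - q r`; dividing by the new `τ`, which
  -- is `(1 - q) τ`, gives the witness.
  · refine ⟨ζd - (α * p.η₁ / ((1 - α * p.η₁) * z.τ)) • rd, ?_, ?_⟩
    · refine (mul_le_mul_of_nonneg_right ?_ hV.le).trans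
        (perturbation_le hq0 hV hαV hτ hrd hcϑ hζd)
      refine (norm_sub_le _ _).trans ?_
      rw [norm_smul, Real.norm_of_nonneg hcoef]
    · have e : P.dualRes (z.y + α • Δy) (z.S + α • ΔS) =
          P.dualRes z.y z.S + α • (P.adj Δy + ΔS) := by
        simp only [Problem.dualRes, P.adj_add, P.adj_smul]
        module
      change P.dualRes (z.y + α • Δy) (z.S + α • ΔS) = ((1 - α * p.η₁) * z.τ) • _
      rw [e, hN1, hd, ← add_sub_assoc, smul_sub _ _ (_ • rd), smul_smul _ _ rd, hcancel]
      module
  · refine ⟨ζp - (α * p.η₁ / ((1 - α * p.η₁) * z.τ)) • rp, ?_, ?_⟩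
    · have hrp' : ‖P.pinv rp‖ ≤ p.γ₁ * ρ * z.τ * ϑ :=
        le_of_mul_le_mul_left ((P.norm_pinv_le hϑhat hadj rp).trans hrp) hϑhat
      refine (mul_le_mul_of_nonneg_right ?_ hV.le).trans
        (perturbation_le hq0 hV hαV hτ hrp' hcϑ hζp)
      rw [sub_eq_add_neg, ← neg_smul, P.pinv_add, P.pinv_smul]
      refine (norm_add_le _ _).trans ?_
      rw [norm_smul, norm_neg, Real.norm_of_nonneg hcoef]
    · have e : P.primalRes (z.X + α • ΔX) = P.primalRes z.X + α • P.op ΔX := by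
        simp only [Problem.primalRes, P.op_add, P.op_smul]
        module
      change P.primalRes (z.X + α • ΔX) = ((1 - α * p.η₁) * z.τ) • _
      rw [e, hN2, hp, ← add_sub_assoc, smul_sub _ _ (_ • rp), smul_smul _ _ rp, hcancel]
      module

theorem move_mem_neighborhood {P : Problem m n} {p : Params} {ρ : ℝ} {y₀ : Vec m}
    (hρ : 0 < ρ) {z : Iterate m n} (hz : z ∈ neighborhood P p ρ y₀) (hθ : 0 < z.θ)
    {ϑhat ϑ V s : ℝ} (hV : 0 < V) (hsV : s ≤ V) {d : Triple m n}
    (hdir : IsInexactDirection P p ρ ϑhat ϑ z d) {cS cX α : ℝ}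
    (hcS : ‖(CFC.sqrt z.S)⁻¹ * d.2.2 * (CFC.sqrt z.S)⁻¹‖ ≤ cS)
    (hcX : ‖CFC.sqrt z.S * d.1 * CFC.sqrt z.S‖ ≤ cX * (z.θ * ρ ^ 2))
    (hα0 : 0 ≤ α) (hα1 : α ≤ 1) (hαS : α * cS < 1) (hαX : α * cX ≤ 1 - p.γ₂)
    (hαXS : α * (cX * cS) ≤ 1 / 2 * (1 - p.η₂) * p.γ₂)
    (htr : Tracked P p ρ y₀ V s (move p z d α)) :
    move p z d α ∈ neighborhood P p ρ y₀ := by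
  obtain ⟨hτ', -, -, ⟨ζd, hζd, hd⟩, ⟨ζp, hζp, hp⟩⟩ := htr
  obtain ⟨hτ0, hτθ, hX, hS, -, -, hc⟩ := hz
  obtain ⟨⟨hdX, hdS⟩, ⟨rd, rp, rc⟩, hN, -, -, hrc⟩ := hdir
  obtain ⟨ΔX, Δy, ΔS⟩ := d
  simp only [Problem.newton, Problem.newtonRhs, Prod.mk.injEq] at hN hdX hdS hrc hcS hcX
  obtain ⟨-, -, hN3⟩ := hN
  have hXs : z.X.IsSymm := isSymm_of_posSemidef hX
  rw [hkm_mul_self hS hXs] at hc hN3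
  rw [hkm_newton hS] at hN3
  have hγ₁ := p.γ₁_mem
  have hγ₂ := p.γ₂_mem
  have hη₂ := p.η₂_mem
  set T := CFC.sqrt z.S with hTdef
  have hT : IsUnit T.det := isUnit_det_sqrt hS
  have hTs : T.IsSymm := sqrt_transpose z.S
  have hWs : (T⁻¹).IsSymm := by rw [IsSymm, transpose_nonsing_inv, hTs.eq]
  set μ := z.θ * ρ ^ 2 with hμdef
  have hμ : 0 < μ := by positivity
  have hMs : (T * z.X * T).IsSymm := by
    simp only [IsSymm, transpose_mul, hTs.eq, hXs.eq, Matrix.mul_assoc]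
  have hDX : (T * ΔX * T).IsSymm := by
    simp only [IsSymm, transpose_mul, hTs.eq, hdX.eq, Matrix.mul_assoc]
  have hDS : (T⁻¹ * ΔS * T⁻¹).IsSymm := by
    simp only [IsSymm, transpose_mul, hWs.eq, hdS.eq, Matrix.mul_assoc]
  have hTTi : ∀ Y : Mat n, T * (T⁻¹ * Y * T⁻¹) * T = Y := fun Y => by
    rw [← Matrix.mul_assoc, nonsing_inv_mul_cancel_right _ _ hT,
      mul_nonsing_inv_cancel_left _ _ hT]
  have hTiT : ∀ Y : Mat n, T⁻¹ * (T * Y * T) * T⁻¹ = Y := fun Y => by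
    rw [← Matrix.mul_assoc, mul_nonsing_inv_cancel_right _ _ hT,
      nonsing_inv_mul_cancel_left _ _ hT]
  have hTT : T * T = z.S := sqrt_mul_sqrt hS.posSemidef
  have hS' : (z.S + α • ΔS).PosDef := by
    have h1 : ((1 : ℝ) • (1 : Mat n) + α • (T⁻¹ * ΔS * T⁻¹)).PosDef := by
      refine posDef_smul_one_add (hDS.smul α) ?_
      rw [norm_smul, Real.norm_of_nonneg hα0]
      exact (mul_le_mul_of_nonneg_left hcS hα0).trans_lt hαS
    have h2 : z.S + α • ΔS = T * ((1 : ℝ) • (1 : Mat n) + α • (T⁻¹ * ΔS * T⁻¹)) * Tᵀ := by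
      rw [hTs.eq, Matrix.mul_add, Matrix.add_mul, one_smul, Matrix.mul_one, hTT, Matrix.mul_smul,
        Matrix.smul_mul, hTTi]
    rw [h2, ← conjTranspose_eq_transpose_of_trivial]
    exact h1.mul_mul_conjTranspose_same
      (vecMul_injective_iff_isUnit.2 ((isUnit_iff_isUnit_det T).2 hT))
  have hX' : (z.X + α • ΔX).PosSemidef := by
    have h1 : (μ • (1 : Mat n) + ((T * z.X * T - μ • (1 : Mat n)) + α • (T * ΔX * T))).PosSemidef := by
      refine posSemidef_smul_one_add ((hMs.sub (by simp [IsSymm])).add (hDX.smul α)) ?_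
      refine (norm_add_le _ _).trans ?_
      rw [norm_smul, Real.norm_of_nonneg hα0]
      have h3 := mul_le_mul_of_nonneg_left hcX hα0
      have h4 := mul_le_mul_of_nonneg_right hαX hμ.le
      linarith
    have h2 : z.X + α • ΔX = T⁻¹ * (μ • (1 : Mat n) +
        ((T * z.X * T - μ • (1 : Mat n)) + α • (T * ΔX * T))) * (T⁻¹)ᵀ := by
      have h3 : μ • (1 : Mat n) + ((T * z.X * T - μ • (1 : Mat n)) + α • (T * ΔX * T)) =
          T * (z.X + α • ΔX) * T := by
        rw [Matrix.mul_add, Matrix.add_mul, Matrix.mul_smul, Matrix.smul_mul]; abel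
      rw [h3, hWs.eq, hTiT]
    rw [h2, ← conjTranspose_eq_transpose_of_trivial]
    exact h1.mul_mul_conjTranspose_same _
  have hζ : ∀ {x : ℝ}, x * V ≤ p.γ₁ * ρ * s → x ≤ p.γ₁ * ρ := fun h =>
    le_of_mul_le_mul_right
      (h.trans (mul_le_mul_of_nonneg_left hsV (mul_pos hγ₁.1 hρ).le)) hV
  refine ⟨hτ'.le, ?_, hX', hS', ⟨ζd, hζ hζd, hd⟩, ⟨ζp, hζ hζp, hp⟩, ?_⟩
  · have h1 : α * p.η₂ ≤ α * p.η₁ := mul_le_mul_of_nonneg_left p.η₂_le hα0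
    have h2 : α * p.η₂ ≤ 1 := mul_le_one₀ hα1 hη₂.1.le hη₂.2.le
    exact mul_le_mul (by linarith) hτθ hτ0 (by linarith)
  · change ‖hkm (z.S + α • ΔS) ((z.X + α • ΔX) * (z.S + α • ΔS)) -
      ((1 - α * p.η₂) * z.θ * ρ ^ 2) • (1 : Mat n)‖ ≤ p.γ₂ * ((1 - α * p.η₂) * z.θ * ρ ^ 2)
    have hrc' : ‖rc‖ ≤ 1 / 2 * (1 - p.η₂) * p.γ₂ * μ := by
      refine hrc.trans_eq ?_
      rw [complTol, hμdef]; ring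
    have hN3' : symmPart (T * z.X * T * (T⁻¹ * ΔS * T⁻¹) + T * ΔX * T) =
        ((1 - p.η₂) * μ) • (1 : Mat n) - T * z.X * T + rc := by
      rw [hN3, hμdef, mul_assoc]
    have hαXS' : α * (‖T * ΔX * T‖ * ‖T⁻¹ * ΔS * T⁻¹‖) ≤ 1 / 2 * (1 - p.η₂) * p.γ₂ * μ := by
      have h1 := mul_le_mul hcX hcS (norm_nonneg _) ((norm_nonneg _).trans hcX)
      have h2 := mul_le_mul_of_nonneg_left h1 hα0
      have h3 := mul_le_mul_of_nonneg_right hαXS hμ.le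
      linarith
    have hstep := norm_symmPart_step_le hc hMs hN3' hrc' hα0 hα1 hαXS'
    have hB : hkm z.S ((z.X + α • ΔX) * (z.S + α • ΔS)) =
        symmPart ((T * z.X * T + α • (T * ΔX * T)) * (1 + α • (T⁻¹ * ΔS * T⁻¹))) := by
      have h1 : T * z.X * T + α • (T * ΔX * T) = T * (z.X + α • ΔX) * T := by
        rw [Matrix.mul_add, Matrix.add_mul, Matrix.mul_smul, Matrix.smul_mul]
      have h2 : 1 + α • (T⁻¹ * ΔS * T⁻¹) = T⁻¹ * (z.S + α • ΔS) * T⁻¹ := by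
        rw [Matrix.mul_add, Matrix.add_mul, Matrix.mul_smul, Matrix.smul_mul, ← hTT,
          nonsing_inv_mul_cancel_left _ _ hT, mul_nonsing_inv _ hT]
      rw [hkm_eq_symmPart, h1, h2]
      congr 1
      simp only [← hTdef, Matrix.mul_assoc]
      rw [mul_nonsing_inv_cancel_left _ _ hT]
    rw [mul_assoc (1 - α * p.η₂)]
    -- The neighbourhood measures centrality in the scaling of the new `S`, but the Newton equation
    -- holds in that of the old one.
    refine (norm_hkm_mul_self_sub_le hS hS' (isSymm_of_posSemidef hX') _).trans ?_
    rw [hB]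
    exact hstep

end Step

/-! ### Step length and convergence along a run -/

section Run

/-- The constant `c` such that a step of length `c / n²` is always admissible. -/
noncomputable def stepConst (p : Params) : ℝ :=
  -- The four bounds in order: `S` stays positive definite, `X` stays positive semidefinite, the
  -- quadratic term is absorbed, and the step respects the cap `1 / (η₁ (1 + ∑ ϑ))`.
  min (1 / (2 * dualConst p)) (min ((1 - p.γ₂) / primalConst p)
    (min (1 / 2 * (1 - p.η₂) * p.γ₂ / (primalConst p * dualConst p))
      (1 / (3 + ∑' j : ℕ, 1 / ((j : ℝ) + 1) ^ (1.1 : ℝ)))))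

theorem tsum_one_div_succ_rpow_nonneg : 0 ≤ ∑' j : ℕ, 1 / ((j : ℝ) + 1) ^ (1.1 : ℝ) :=
  tsum_nonneg fun _ => by positivity

theorem stepConst_pos (p : Params) : 0 < stepConst p := by
  have h1 := dualConst_pos p
  have h2 := primalConst_pos p
  have h3 : 0 < 1 - p.γ₂ := sub_pos.2 p.γ₂_mem.2
  have h4 : 0 < 1 - p.η₂ := sub_pos.2 p.η₂_mem.2
  have h5 := p.γ₂_mem.1
  have h6 := tsum_one_div_succ_rpow_nonneg
  unfold stepConst
  refine lt_min ?_ (lt_min ?_ (lt_min ?_ ?_)) <;> positivity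

theorem stepConst_mul_dualConst_lt (p : Params) : stepConst p * dualConst p < 1 := by
  have h1 := dualConst_pos p
  have h2 : stepConst p ≤ 1 / (2 * dualConst p) := min_le_left _ _
  have h3 := mul_le_mul_of_nonneg_right h2 h1.le
  have h4 : 1 / (2 * dualConst p) * dualConst p = 1 / 2 := by field_simp
  linarith

theorem stepConst_mul_primalConst_le (p : Params) :
    stepConst p * primalConst p ≤ 1 - p.γ₂ :=
  (le_div_iff₀ (primalConst_pos p)).1 ((min_le_right _ _).trans (min_le_left _ _))

theorem stepConst_mul_mul_le (p : Params) :
    stepConst p * (primalConst p * dualConst p) ≤ 1 / 2 * (1 - p.η₂) * p.γ₂ :=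
  (le_div_iff₀ (mul_pos (primalConst_pos p) (dualConst_pos p))).1
    ((min_le_right _ _).trans ((min_le_right _ _).trans (min_le_left _ _)))

theorem stepConst_mul_le_one (p : Params) :
    stepConst p * (3 + ∑' j : ℕ, 1 / ((j : ℝ) + 1) ^ (1.1 : ℝ)) ≤ 1 :=
  (le_div_iff₀ (by linarith [tsum_one_div_succ_rpow_nonneg])).1
    ((min_le_right _ _).trans ((min_le_right _ _).trans (min_le_right _ _)))

/-- The step length `stepConst p / n²` satisfies the upper bound of the line search. -/
theorem stepConst_div_mem_Icc (p : Params) (hn : 1 ≤ n) {ε : ℝ} (hε0 : 0 < ε) (hε1 : ε < 1) :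
    stepConst p / (n : ℝ) ^ 2 ∈
      Set.Icc 0 (min 1 (1 / (p.η₁ * (1 + ∑' j, vartheta n ε j)))) := by
  have hc := stepConst_pos p
  have h1 := stepConst_mul_le_one p
  have hZ := tsum_one_div_succ_rpow_nonneg
  have hV := tsum_vartheta_le hn hε0 hε1
  have hV0 := tsum_vartheta_pos hn hε0 hε1
  set Z := ∑' j : ℕ, 1 / ((j : ℝ) + 1) ^ (1.1 : ℝ)
  set V := ∑' j, vartheta n ε j
  have hn2 : (1 : ℝ) ≤ (n : ℝ) ^ 2 := one_le_pow₀ (by exact_mod_cast hn)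
  have hη0 := p.η₁_mem.1
  have hη1 := p.η₁_mem.2
  refine ⟨by positivity, le_min ?_ ?_⟩
  · rw [div_le_one (by linarith)]
    nlinarith
  · rw [div_le_div_iff₀ (by linarith) (by positivity)]
    have h2 : p.η₁ * (1 + V) ≤ 1 * ((3 + Z) * (n : ℝ) ^ 2) :=
      mul_le_mul hη1 (by linarith) (by linarith) zero_le_one
    have h3 := mul_le_mul_of_nonneg_left h2 hc.le
    have h4 := mul_le_mul_of_nonneg_right h1 (zero_le_one.trans hn2)
    linarith

theorem IsRun.mem_neighborhood {P : Problem m n} {p : Params} {ρ : ℝ} (hρ : 0 < ρ) {y₀ : Vec m}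
    {ε : ℝ} {dir : ℕ → Iterate m n → Triple m n → Prop} {k : ℕ} {z : ℕ → Iterate m n}
    (h : IsRun P p ρ y₀ ε dir k z) : ∀ i ≤ k, z i ∈ neighborhood P p ρ y₀ := by
  rintro (_ | i) hi
  · rw [h.1]; exact start_mem_neighborhood P p hρ y₀
  · obtain ⟨d, α, -, ⟨⟨-, hmem⟩, -⟩, hz⟩ := h.2 i hi
    rwa [hz]

/-- A run whose search directions are tomography estimates with the prescribed errors is a run
with inexact search directions. -/
theorem IsRun.of_tomography {P : Problem m n} {p : Params} {ρ : ℝ} (hρ : 0 < ρ) (hn : 1 ≤ n)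
    {y₀ : Vec m} {ϑhat : ℝ} (hϑhat : 0 < ϑhat) {ε : ℝ} (hε0 : 0 < ε) (hε1 : ε < 1) {k : ℕ}
    {z : ℕ → Iterate m n} {ϱ : ℝ} {L ξ : ℕ → ℝ} (hϱ : 0 < ϱ) (hL : ∀ i, 0 < L i)
    (h : IsRun P p ρ y₀ ε (fun i w d =>
      IsPrescribedError P p ρ ϑhat (vartheta n ε i) ϱ (L i) (ξ i) w ∧
        IsTomographyEstimate P p ρ ϱ (ξ i) w d) k z) :
    IsRun P p ρ y₀ ε (fun i => IsInexactDirection P p ρ ϑhat (vartheta n ε i)) k z := by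
  refine ⟨h.1, fun i hi => ?_⟩
  obtain ⟨hτ, hτθ, -⟩ := h.mem_neighborhood hρ i hi.le
  obtain ⟨d, α, ⟨hξ, hd⟩, hα, hz⟩ := h.2 i hi
  exact ⟨d, α, hd.isInexactDirection hρ hϑhat (vartheta_nonneg hn hε0 hε1 i) hϱ (hL i) hτ
    (hτ.trans hτθ) hξ, hα, hz⟩

theorem IsRun.tracked_and_θ_le {P : Problem m n} {p : Params} {ρ : ℝ} {y₀ : Vec m}
    (hn : 1 ≤ n) (hρ : 0 < ρ) {Xs Ss : Mat n} {ys : Vec m} (hopt : P.IsOptimal Xs ys Ss)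
    (hXle : (ρ • (1 : Mat n) - Xs).PosSemidef) (hSle : (ρ • (1 : Mat n) - Ss).PosSemidef)
    (htr : 1 / (n : ℝ) * (Xs.trace + Ss.trace) ≤ ρ) {ϑhat : ℝ} (hϑhat : 0 < ϑhat)
    (hadj : ∀ v : Vec m, ϑhat * ‖v‖ ≤ ‖P.adj v‖) {ε : ℝ} (hε0 : 0 < ε) (hε1 : ε < 1) {k : ℕ}
    {z : ℕ → Iterate m n}
    (h : IsRun P p ρ y₀ ε (fun i => IsInexactDirection P p ρ ϑhat (vartheta n ε i)) k z) :
    ∀ i ≤ k, Tracked P p ρ y₀ (∑' j, vartheta n ε j) (∑ j ∈ Finset.range i, vartheta n ε j) (z i) ∧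
      (z i).θ ≤ (1 - stepConst p / (n : ℝ) ^ 2 * p.η₂) ^ i := by
  have hV := tsum_vartheta_pos hn hε0 hε1
  have hsV : ∀ i, ∑ j ∈ Finset.range i, vartheta n ε j ≤ ∑' j, vartheta n ε j := fun i =>
    (summable_vartheta hn hε0 hε1).sum_le_tsum _ fun j _ => vartheta_nonneg hn hε0 hε1 j
  have hn1 : (1 : ℝ) ≤ n := by exact_mod_cast hn
  have hn0 : (0 : ℝ) < (n : ℝ) ^ 2 := by positivity
  have hη₁ := p.η₁_mem
  have hη₂ := p.η₂_mem
  have hbound : ∀ {a : ℝ}, a ∈ Set.Icc 0 (min 1 (1 / (p.η₁ * (1 + ∑' j, vartheta n ε j)))) →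
      a ≤ 1 ∧ a * p.η₁ * (1 + ∑' j, vartheta n ε j) ≤ 1 := fun ha => by
    refine ⟨ha.2.trans (min_le_left _ _), ?_⟩
    rw [mul_assoc]
    exact (le_div_iff₀ (mul_pos hη₁.1 (by linarith))).1 (ha.2.trans (min_le_right _ _))
  have hcIcc := stepConst_div_mem_Icc p hn hε0 hε1
  set c := stepConst p / (n : ℝ) ^ 2 with hc
  have hcpos : 0 < c := div_pos (stepConst_pos p) hn0
  intro i
  induction i with
  | zero =>
    intro _
    rw [h.1]
    exact ⟨by simpa using tracked_start P p ρ y₀ _, le_of_eq (pow_zero _).symm⟩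
  | succ i ih =>
    intro hi
    obtain ⟨htrack, hθ⟩ := ih (Nat.le_of_succ_le hi)
    have hmem := h.mem_neighborhood hρ i (Nat.le_of_succ_le hi)
    obtain ⟨d, α, hdir, ⟨⟨hα, -⟩, hgreatest⟩, hz⟩ := h.2 i hi
    have hϑ0 := vartheta_nonneg hn hε0 hε1 i
    have hmove : ∀ {a : ℝ}, a ∈ Set.Icc 0 (min 1 (1 / (p.η₁ * (1 + ∑' j, vartheta n ε j)))) →
        Tracked P p ρ y₀ (∑' j, vartheta n ε j) (∑ j ∈ Finset.range (i + 1), vartheta n ε j)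
          (move p (z i) d a) := fun ha => by
      rw [Finset.sum_range_succ]
      exact htrack.move hρ hV hϑhat hadj hϑ0 hdir ha.1 (hbound ha).2
    obtain ⟨hdS, hdX⟩ := hdir.norm_le hn hρ hopt hXle hSle htr hϑhat hadj (vartheta_le_one i)
      hmem htrack.τ_le_one htrack.θ_pos
    have hcn : c * n ≤ stepConst p := by
      rw [hc, div_mul_eq_mul_div, div_le_iff₀ hn0]
      exact mul_le_mul_of_nonneg_left (by nlinarith) (stepConst_pos p).le
    have hcα : c ≤ α := by
      refine hgreatest ⟨hcIcc, move_mem_neighborhood hρ hmem htrack.θ_pos hV (hsV (i + 1)) hdir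
        hdS hdX hcIcc.1 (hbound hcIcc).1 ?_ ?_ ?_ (hmove hcIcc)⟩
      · have := mul_le_mul_of_nonneg_right hcn (dualConst_pos p).le
        linarith [stepConst_mul_dualConst_lt p]
      · have := mul_le_mul_of_nonneg_right hcn (primalConst_pos p).le
        linarith [stepConst_mul_primalConst_le p]
      -- Only this condition uses the full factor `n⁻²`, since both directions are of order `n`; for
      -- the two definiteness conditions `c * n ≤ stepConst p` is enough.
      · have e : c * (primalConst p * n * (dualConst p * n)) =
            stepConst p * (primalConst p * dualConst p) := by
          rw [hc]; field_simp
        rw [e]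
        exact stepConst_mul_mul_le p
    rw [hz]
    refine ⟨hmove hα, ?_⟩
    change (1 - α * p.η₂) * (z i).θ ≤ _
    have h1 : 1 - α * p.η₂ ≤ 1 - c * p.η₂ := by
      linarith [mul_le_mul_of_nonneg_right hcα hη₂.1.le]
    have h2 : 0 ≤ 1 - c * p.η₂ := by
      linarith [mul_le_one₀ (hbound hcIcc).1 hη₂.1.le hη₂.2.le]
    rw [pow_succ']
    exact mul_le_mul h1 hθ htrack.θ_pos.le h2

theorem one_sub_pow_le {q ε : ℝ} {k : ℕ} (hq : q ≤ 1) (hε0 : 0 < ε)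
    (hk : Real.log (1 / ε) ≤ q * k) : (1 - q) ^ k ≤ ε := by
  calc (1 - q) ^ k ≤ Real.exp (-q) ^ k :=
        pow_le_pow_left₀ (sub_nonneg.2 hq) (Real.one_sub_le_exp_neg q) k
    _ = Real.exp (-(q * k)) := by rw [← Real.exp_nat_mul]; congr 1; ring
    _ ≤ Real.exp (Real.log ε) := by
        rw [one_div, Real.log_inv] at hk
        exact Real.exp_le_exp.2 (by linarith)
    _ = ε := Real.exp_log hε0

end Run

end SDO

theorem mainTheorem3 (p : SDO.Params) :
    ∃ K : ℝ, 0 < K ∧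
      ∀ (m n : ℕ) (_ : 1 ≤ n) (P : SDO.Problem m n) (ρ : ℝ) (_ : 0 < ρ)
        (Xs : SDO.Mat n) (ys : SDO.Vec m) (Ss : SDO.Mat n) (_ : P.IsOptimal Xs ys Ss)
        (_ : ((1 - p.γ₁) • (ρ • (1 : SDO.Mat n)) - Xs).PosSemidef)
        (_ : ((1 - p.γ₁) • (ρ • (1 : SDO.Mat n)) - Ss).PosSemidef)
        (_ : 1 / (n : ℝ) * (Xs.trace + Ss.trace) ≤ ρ)
        (y₀ : SDO.Vec m)
        -- `ϑhat` is at most the least singular value of the constraint operator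
        (ϑhat : ℝ) (_ : 0 < ϑhat) (_ : ∀ v : SDO.Vec m, ϑhat * ‖v‖ ≤ ‖P.adj v‖)
        (ε : ℝ) (_ : 0 < ε) (_ : ε < 1) (k : ℕ)
        (_ : K * (n : ℝ) ^ 2 * Real.log (1 / ε) ≤ k) (z : ℕ → SDO.Iterate m n),
        -- any inexact search directions
        (SDO.IsRun P p ρ y₀ ε
            (fun i => SDO.IsInexactDirection P p ρ ϑhat (SDO.vartheta n ε i)) k z →
          (z k).θ ≤ ε ∧ (z k).τ ≤ ε) ∧
        -- directions obtained by tomography with the prescribed errors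
        (∀ (ϱ : ℝ) (L ξ : ℕ → ℝ), 0 < ϱ → (∀ i, 0 < L i) →
          SDO.IsRun P p ρ y₀ ε
            (fun i w d =>
              SDO.IsPrescribedError P p ρ ϑhat (SDO.vartheta n ε i) ϱ (L i) (ξ i) w ∧
                SDO.IsTomographyEstimate P p ρ ϱ (ξ i) w d) k z →
          (z k).θ ≤ ε ∧ (z k).τ ≤ ε) := by
  have hc := SDO.stepConst_pos p
  have hη := p.η₂_mem
  have hcη : 0 < SDO.stepConst p * p.η₂ := mul_pos hc hη.1
  -- Each step contracts `θ` by at least `1 - stepConst p * η₂ / n²`, so this `K` makes the total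
  -- exponent at least `log (1 / ε)`.
  refine ⟨1 / (SDO.stepConst p * p.η₂), one_div_pos.2 hcη, ?_⟩
  intro m n hn P ρ hρ Xs ys Ss hopt hX hS htr y₀ ϑhat hϑhat hadj ε hε0 hε1 k hk z
  -- Adding `γ₁ ρ I` weakens the domination to `ρ I - Q ⪰ 0`, the form in which the shift estimates
  -- use it.
  have hrelax : ∀ {Q : SDO.Mat n}, ((1 - p.γ₁) • (ρ • (1 : SDO.Mat n)) - Q).PosSemidef →
      (ρ • (1 : SDO.Mat n) - Q).PosSemidef := fun {Q} hQ => by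
    have h := hQ.add (Matrix.PosSemidef.one.smul (mul_pos p.γ₁_mem.1 hρ).le)
    have e : (1 - p.γ₁) • (ρ • (1 : SDO.Mat n)) - Q + (p.γ₁ * ρ) • (1 : SDO.Mat n) =
        ρ • (1 : SDO.Mat n) - Q := by module
    rwa [e] at h
  have main : SDO.IsRun P p ρ y₀ ε
      (fun i => SDO.IsInexactDirection P p ρ ϑhat (SDO.vartheta n ε i)) k z →
      (z k).θ ≤ ε ∧ (z k).τ ≤ ε := fun hrun => by
    have hθ := (hrun.tracked_and_θ_le hn hρ hopt (hrelax hX) (hrelax hS) htr hϑhat hadj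
      hε0 hε1 k le_rfl).2
    have hn0 : (0 : ℝ) < (n : ℝ) ^ 2 := by positivity
    have hstep := (SDO.stepConst_div_mem_Icc p hn hε0 hε1).2.trans (min_le_left _ _)
    have hle : (z k).θ ≤ ε := by
      refine hθ.trans (SDO.one_sub_pow_le (mul_le_one₀ hstep hη.1.le hη.2.le) hε0 ?_)
      rw [div_mul_eq_mul_div, div_mul_eq_mul_div, le_div_iff₀ hn0]
      rw [mul_assoc, div_mul_eq_mul_div, one_mul, div_le_iff₀ hcη] at hk
      linarith
    exact ⟨hle, (hrun.mem_neighborhood hρ k le_rfl).2.1.trans hle⟩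
  exact ⟨main, fun ϱ L ξ hϱ hL hrun => main (hrun.of_tomography hρ hn hϑhat hε0 hε1 hϱ hL)⟩
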